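/- Let $n \ge 3$. For $l>0$ let $P, Q \subset \mathbb{H}^n$ be two hyperplanes at hyperbolic distance $l$ (unique up to isometry), and let $V_l \subset T_1\mathbb{H}^n$ be the set of unit tangent vectors $v$ that are tangent to a geodesic arc running from $P$ to $Q$ or from $Q$ to $P$ (the base point of $v$ lying on the arc). Let $\mathrm{Vol}$ on $T_1\mathbb{H}^n$ be the natural volume $d\Omega = dV\,d\omega$, with $dV$ the hyperbolic volume and $d\omega$ the standard volume on the unit sphere $\mathbb{S}^{n-1}$. The $n$-th Bridgeman–Kahn function is $$F_n(l) = \frac{\mathrm{Vol}(V_l)}{\mathrm{Vol}(\mathbb{S}^{n-1})}, \qquad l>0 .$$ (Equivalently, $\mathrm{Vol}(\mathbb{S}^{n-1})\,F_n(l)$ is the volume of the set of unit tangent vectors $v$ of a hyperbolic $n$-manifold $M$ with totally geodesic boundary whose maximal geodesic in $M$ has finite length and is homotopic, relative to $\partial M$, to a given orthogeodesic of length $l$.) Write $H(m) = \sum_{k=1}^m \frac1k$. Then $F_n(l)$ is finite for every $l>0$, and: 1. there exists $D_n>0$, depending only on $n$, such that for all $l>0$ $$F_n(l) \le \frac{D_n}{(e^l-1)^{n-2}};$$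 2. $$\lim_{l\to 0^+} l^{n-2} F_n(l) = \frac{\pi^{\frac{n-2}{2}}\, H(n-2)\, \Gamma\!\left(\frac{n-2}{2}\right)}{\Gamma\!\left(\frac{n-1}{2}\right)\Gamma\!\left(\frac{n+1}{2}\right)};$$ 3. $$\lim_{l\to\infty} \frac{e^{(n-1)l}}{l}\,F_n(l) = \frac{2^{n-1}\,\pi^{\frac{n-2}{2}}\,\Gamma\!\left(\frac n2\right)}{\Gamma\!\left(\frac{n+1}{2}\right)^2}.$$ -/

import Mathlib

open Real Set Filter Topology MeasureTheory

noncomputable section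

namespace BridgemanKahn

/-! Hyperbolic space of dimension `n ≥ 1` in the upper half-space model: the points of `ℝⁿ` whose
vertical coordinate is positive. The vertical coordinate is the one with index `0`. -/

/-- Euclidean `n`-space. -/
abbrev Euc (n : ℕ) : Type := EuclideanSpace ℝ (Fin n)

/-- The upper half-space `𝕌ⁿ`. -/
def upperHalfSpace (n : ℕ) [NeZero n] : Set (Euc n) := {x | 0 < x 0}

/-- The upward Euclidean unit vector. -/
def vert (n : ℕ) [NeZero n] : Euc n := EuclideanSpace.single 0 1

/-- The hyperbolic distance `d`, given by `cosh d(x, y) = 1 + |x - y|² / (2 x₀ y₀)`. It is the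
distance of the metric `ds = |dx| / x₀`. -/
def hypDist {n : ℕ} [NeZero n] (x y : Euc n) : ℝ :=
  arcosh (1 + ‖x - y‖ ^ 2 / (2 * x 0 * y 0))

/-- The hyperbolic volume `dV = dx / x₀ⁿ` on the upper half-space (as a measure on `ℝⁿ`
that is zero outside the upper half-space). -/
def hypVolume (n : ℕ) [NeZero n] : Measure (Euc n) :=
  (volume.restrict (upperHalfSpace n)).withDensity fun x => ENNReal.ofReal ((x 0 ^ n)⁻¹)

/-- The Euclidean unit sphere `𝕊ⁿ⁻¹` of directions. -/
abbrev Dir (n : ℕ) : Type := Metric.sphere (0 : Euc n) 1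

/-- The standard surface measure `dω` of `𝕊ⁿ⁻¹`. -/
def sphereVolume (n : ℕ) : Measure (Dir n) := (volume : Measure (Euc n)).toSphere

/-- The natural volume `dΩ = dV dω` on the unit tangent bundle `T₁ℍⁿ = 𝕌ⁿ × 𝕊ⁿ⁻¹`: the pair
`(x, ω)` stands for the unit tangent vector `x₀ • ω` at `x`. -/
def unitTangentVolume (n : ℕ) [NeZero n] : Measure (Euc n × Dir n) :=
  (hypVolume n).prod (sphereVolume n)

/-- The complete unit-speed geodesic `γ` with `γ(0) = x` and `γ'(0) = x₀ • ω`. (The facts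
`geodesic_mem`, `geodesic_zero`, `hasDerivAt_geodesic_zero` and `hypDist_geodesic` below say that
it is one.) -/
def geodesic {n : ℕ} [NeZero n] (x : Euc n) (ω : Dir n) (t : ℝ) : Euc n :=
  x + (x 0 / (cosh t - (ω : Euc n) 0 * sinh t)) •
    (sinh t • (ω : Euc n) + (1 - cosh t) • vert n)

/-- The hyperplane of `ℍⁿ` that meets the vertical geodesic `t ↦ (0, eᵗ)` perpendicularly at the
parameter `t`: the Euclidean hemisphere of radius `eᵗ` about the origin. Two of them, with
parameters `0` and `l > 0`, are disjoint and at distance `l` from each other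
(`isLeast_hypDist_hyperplane`), and up to an isometry every pair of hyperplanes at distance `l`
is of this form. -/
def hyperplane (n : ℕ) [NeZero n] (t : ℝ) : Set (Euc n) :=
  {x | x ∈ upperHalfSpace n ∧ ‖x‖ = exp t}

/-- The unit tangent vectors of `ℍⁿ` that are tangent to a geodesic arc running from one of the
sets `P`, `Q` to the other: followed backwards and forwards they meet `P` and `Q`, in one order
or the other. -/
def crossingVectors {n : ℕ} [NeZero n] (P Q : Set (Euc n)) : Set (Euc n × Dir n) :=
  {v | v.1 ∈ upperHalfSpace n ∧ ∃ a ≤ 0, ∃ b ≥ 0,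
    (geodesic v.1 v.2 a ∈ P ∧ geodesic v.1 v.2 b ∈ Q) ∨
    (geodesic v.1 v.2 a ∈ Q ∧ geodesic v.1 v.2 b ∈ P)}

/-- The volume (possibly infinite a priori) of the set of unit vectors that are tangent to an arc
between two hyperplanes of `ℍⁿ` at distance `l`. This is `Vol(V_α)` for an orthogeodesic
`α` of length `l`: the vectors whose maximal geodesic is homotopic to `α` relative to the
boundary lift bijectively to the vectors tangent to an arc between the two boundary hyperplanes
joined by a lift of `α`. -/
def crossingVolume (n : ℕ) [NeZero n] (l : ℝ) : ENNReal :=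
  unitTangentVolume n (crossingVectors (hyperplane n 0) (hyperplane n l))

/-- The Bridgeman-Kahn function: `Vol(𝕊ⁿ⁻¹) · F_n(l) = Vol(V_α)`, where `α` has length `l`. -/
def bridgemanKahn (n : ℕ) [NeZero n] (l : ℝ) : ℝ :=
  (crossingVolume n l).toReal / (sphereVolume n).real univ

/-! Facts that show that the objects above are what their names say. -/

section facts

variable {n : ℕ} [NeZero n]

lemma norm_dir {n : ℕ} (ω : Dir n) : ‖(ω : Euc n)‖ = 1 := by
  simp

lemma abs_coord_le (x : Euc n) : |x 0| ≤ ‖x‖ := by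
  simpa using PiLp.norm_apply_le x 0

lemma denom_pos (ω : Dir n) (t : ℝ) : 0 < cosh t - (ω : Euc n) 0 * sinh t := by
  have h := abs_coord_le (ω : Euc n)
  rw [norm_dir, abs_le] at h
  have h1 := exp_pos t
  have h2 := exp_pos (-t)
  rw [cosh_eq, sinh_eq]
  by_cases hs : (ω : Euc n) 0 = 1
  · rw [hs]; linarith
  · have : (ω : Euc n) 0 < 1 := lt_of_le_of_ne h.2 hs
    nlinarith [mul_pos (sub_pos.2 this) h1, mul_nonneg (by linarith [h.1] : 0 ≤ 1 + (ω : Euc n) 0) h2.le]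

lemma geodesic_coord (x : Euc n) (ω : Dir n) (t : ℝ) :
    geodesic x ω t 0 = x 0 / (cosh t - (ω : Euc n) 0 * sinh t) := by
  have h := (denom_pos ω t).ne'
  simp only [geodesic, vert, PiLp.add_apply, PiLp.smul_apply, smul_eq_mul,
    PiLp.single_apply, if_true]
  field_simp
  ring

/-- The geodesic stays in the upper half-space. -/
theorem geodesic_mem {x : Euc n} (hx : x ∈ upperHalfSpace n) (ω : Dir n) (t : ℝ) :
    geodesic x ω t ∈ upperHalfSpace n := by
  show 0 < geodesic x ω t 0
  rw [geodesic_coord]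
  exact div_pos hx (denom_pos ω t)

theorem geodesic_zero (x : Euc n) (ω : Dir n) : geodesic x ω 0 = x := by
  simp [geodesic]

theorem hasDerivAt_geodesic_zero (x : Euc n) (ω : Dir n) :
    HasDerivAt (geodesic x ω) (x 0 • (ω : Euc n)) 0 := by
  have hd := (hasDerivAt_cosh (0 : ℝ)).sub ((hasDerivAt_sinh (0 : ℝ)).const_mul ((ω : Euc n) 0))
  have h1 := (hasDerivAt_const (0 : ℝ) (x 0)).div hd (denom_pos ω 0).ne'
  have h2 := ((hasDerivAt_sinh (0 : ℝ)).smul_const (ω : Euc n)).add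
    (((hasDerivAt_cosh (0 : ℝ)).const_sub 1).smul_const (vert n))
  have h3 := (h1.smul h2).const_add x
  refine h3.congr_deriv ?_
  simp

/-- The geodesic is parametrized by hyperbolic arc length and minimizes hyperbolic length. -/
theorem hypDist_geodesic {x : Euc n} (hx : x ∈ upperHalfSpace n) (ω : Dir n) (s t : ℝ) :
    hypDist (geodesic x ω s) (geodesic x ω t) = |s - t| := by
  have hx0 : 0 < x 0 := hx
  have hs := denom_pos ω s
  have ht := denom_pos ω t
  rw [hypDist, geodesic_coord, geodesic_coord]
  set c := (ω : Euc n) 0 with hc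
  set A := x 0 / (cosh s - c * sinh s) with hA
  set B := x 0 / (cosh t - c * sinh t) with hB
  have hdiff : geodesic x ω s - geodesic x ω t =
      (A * sinh s - B * sinh t) • (ω : Euc n) +
        (A * (1 - cosh s) - B * (1 - cosh t)) • vert n := by
    simp only [geodesic, ← hc, ← hA, ← hB]
    module
  have hv : ‖vert n‖ = 1 := by simp [vert]
  have hin : inner ℝ (ω : Euc n) (vert n) = c := by
    simp [vert, EuclideanSpace.inner_single_right, hc]
  rw [hdiff, norm_add_sq_real, norm_smul, norm_smul, real_inner_smul_left, real_inner_smul_right,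
    norm_dir, hv, hin, mul_one, mul_one, norm_eq_abs, norm_eq_abs, sq_abs, sq_abs]
  rw [← arcosh_cosh (abs_nonneg (s - t)), cosh_abs, cosh_sub]
  congr 1
  have e1 := cosh_sq s
  have e2 := cosh_sq t
  rw [hA, hB]
  generalize cosh s = C1 at *
  generalize sinh s = S1 at *
  generalize cosh t = C2 at *
  generalize sinh t = S2 at *
  have key : (S1 * (C2 - c * S2) - S2 * (C1 - c * S1)) ^ 2
      + 2 * c * (S1 * (C2 - c * S2) - S2 * (C1 - c * S1)) *
        ((1 - C1) * (C2 - c * S2) - (1 - C2) * (C1 - c * S1))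
      + ((1 - C1) * (C2 - c * S2) - (1 - C2) * (C1 - c * S1)) ^ 2
      = 2 * (C1 * C2 - S1 * S2 - 1) * ((C1 - c * S1) * (C2 - c * S2)) := by
    grind
  have hs' := hs.ne'
  have ht' := ht.ne'
  have hx' := hx0.ne'
  field_simp
  linear_combination key

/-- The hyperplanes with parameters `0` and `l` are at hyperbolic distance `l`. -/
theorem isLeast_hypDist_hyperplane {l : ℝ} (hl : 0 ≤ l) :
    IsLeast {d | ∃ x ∈ hyperplane n 0, ∃ y ∈ hyperplane n l, d = hypDist x y} l := by
  have hv : ‖vert n‖ = 1 := by simp [vert]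
  have hv0 : vert n 0 = 1 := by simp [vert]
  constructor
  · refine ⟨vert n, ⟨by simp [upperHalfSpace, hv0], by simp [hv]⟩, exp l • vert n,
      ⟨by simp [upperHalfSpace, hv0, exp_pos], by simp [norm_smul, hv]⟩, ?_⟩
    have h1 : vert n - exp l • vert n = (1 - exp l) • vert n := by module
    rw [hypDist, h1, norm_smul, hv, PiLp.smul_apply, hv0, mul_one, norm_eq_abs, sq_abs]
    conv_lhs => rw [← arcosh_cosh hl]
    congr 1
    rw [cosh_eq, exp_neg]
    have := exp_pos l
    simp only [smul_eq_mul]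
    field_simp
    ring
  · rintro d ⟨x, ⟨hx, hxn⟩, y, ⟨hy, hyn⟩, rfl⟩
    have hx0 : 0 < x 0 := hx
    have hy0 : 0 < y 0 := hy
    rw [exp_zero] at hxn
    have he := exp_pos l
    rw [hypDist]
    conv_lhs => rw [← arcosh_cosh hl]
    rw [arcosh_le_arcosh (cosh_pos l) (by positivity)]
    have hin : inner ℝ x y ≤ exp l := by
      have := real_inner_le_norm x y
      rwa [hxn, hyn, one_mul] at this
    have hxy : x 0 * y 0 ≤ exp l := by
      have h1 := abs_coord_le x
      have h2 := abs_coord_le y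
      rw [hxn, abs_of_pos hx0] at h1
      rw [hyn, abs_of_pos hy0] at h2
      nlinarith
    rw [norm_sub_sq_real, hxn, hyn, cosh_eq, exp_neg]
    have hp : 0 < x 0 * y 0 := mul_pos hx0 hy0
    generalize exp l = E at *
    have h1 : (E - 1) ^ 2 * (x 0 * y 0) ≤ (E - 1) ^ 2 * E :=
      mul_le_mul_of_nonneg_left hxy (sq_nonneg _)
    have h2 : (E - 1) ^ 2 * (x 0 * y 0) / E ≤ (E - 1) ^ 2 := by
      rw [div_le_iff₀ he]; exact h1
    have h3 : (E - 1) ^ 2 * (x 0 * y 0) / E = (E + E⁻¹ - 2) * (x 0 * y 0) := by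
      field_simp
      ring
    rw [← sub_le_iff_le_add', le_div_iff₀ (by positivity)]
    nlinarith

end facts

end BridgemanKahn

end

noncomputable section

namespace BridgemanKahn

/-! ### Integration in polar coordinates -/

/-! Put `n = d + 1`, `m = d - 1` and `E = exp l`. Apart from the vertical ones, geodesics of the
half-space are semicircles, given by a centre `c`, a radius `R` and a horizontal direction `e`; a
unit vector is such a semicircle together with the time `t` elapsed since its highest point. In
these coordinates the volume is `R^(-(d+1)) dR dc dt de`, so integrating over `t` leaves the length
of the arc cut out by the two hemispheres (`crossingVolume_eq_lintegral_arc`). Passing to the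
endpoints `p`, `q` gives the integral of `|q - p|^(-2d)` times that length over `|p| < 1`, `|q| >
E`, with the factor `2^(d+1)` (`crossingVolume_eq_lintegral_endpoints`).

The length is half the logarithm of a cross ratio of squared norms, and it splits into a function of
`|p|` plus the same function of `E/|q|` (`arcLength_eq_add`). In each summand the other endpoint is
integrated out by inversion, which turns the kernel into the volume of a ball. The inversion `q ↦ E
q / |q|^2` shows that the two summands contribute equally. What remains is an explicit integral over
`0 < ρ < 1`, the `radialIntegral`.

For small `l` the mass sits near `ρ = 1`. The substitution `ρ = 1 - (E - 1) a` extracts `(E -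
1)^(-m)` and leaves an integrand dominated, uniformly in `E`, by `(1 + a)^(-(m+1)) log ((1 + a)/a)`,
whose integral is `H(m)/m` (`lintegral_harmonic`). This gives finiteness and the upper bound at
once, and the limit at `0` by dominated convergence. For large `l` the logarithm is asymptotic to
`l` and the other factor to `exp (-d l)`, so that `∫ ρ^(d-1) = 1/d` survives. -/

/-- Integration in polar coordinates. -/
theorem lintegral_polar {m : ℕ} (hm : m ≠ 0) {f : Euc m → ENNReal} (hf : Measurable f) :
    ∫⁻ x, f x = ∫⁻ ω : Dir m, ∫⁻ r in Ioi (0 : ℝ),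
      ENNReal.ofReal (r ^ (m - 1)) * f (r • (ω : Euc m)) ∂volume ∂(sphereVolume m) := by
  have : Nontrivial (Euc m) := by
    have := Fin.pos_iff_nonempty.1 (Nat.pos_of_ne_zero hm)
    infer_instance
  have h := (volume : Measure (Euc m)).measurePreserving_homeomorphUnitSphereProd
  have hfin : Module.finrank ℝ (Euc m) = m := by simp
  have hg : Measurable fun p : Dir m × Ioi (0 : ℝ) => f ((p.2 : ℝ) • (p.1 : Euc m)) := by
    fun_prop
  have h2 := h.lintegral_comp hg
  have h3 : ∀ x : ({0}ᶜ : Set (Euc m)),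
      ((homeomorphUnitSphereProd (Euc m) x).2 : ℝ) • ((homeomorphUnitSphereProd (Euc m) x).1 : Euc m)
        = x := by
    intro x
    have hx : ‖(x : Euc m)‖ ≠ 0 := norm_ne_zero_iff.2 x.2
    simp [smul_smul, hx]
  simp only [h3] at h2
  rw [lintegral_subtype_comap (measurableSet_singleton _).compl, restrict_compl_singleton,
    lintegral_prod _ hg.aemeasurable] at h2
  rw [h2, sphereVolume]
  refine lintegral_congr fun ω => ?_
  rw [Measure.volumeIoiPow, lintegral_withDensity_eq_lintegral_mul _ (by fun_prop) (by fun_prop),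
    hfin]
  simp only [Pi.mul_apply]
  rw [lintegral_subtype_comap measurableSet_Ioi
    (fun r : ℝ => ENNReal.ofReal (r ^ (m - 1)) * f (r • (ω : Euc m)))]

/-- Scaling of the half-line. -/
theorem lintegral_Ioi_scale {a : ℝ} (ha : 0 < a) (f : ℝ → ENNReal) :
    ∫⁻ r in Ioi (0 : ℝ), f r = ∫⁻ r in Ioi (0 : ℝ), ENNReal.ofReal a * f (a * r) := by
  have him : (fun r : ℝ => a * r) '' Ioi 0 = Ioi 0 := by
    rw [image_mul_left_Ioi ha, mul_zero]
  conv_lhs => rw [← him]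
  rw [lintegral_image_eq_lintegral_abs_deriv_mul (f' := fun _ => a) measurableSet_Ioi
    (fun x _ => by simpa using ((hasDerivAt_id x).const_mul a).hasDerivWithinAt)
    (mul_right_injective₀ ha.ne').injOn]
  simp [abs_of_pos ha]

/-- The substitution `y = -(ρ sinh t)` on the line. -/
theorem lintegral_eq_lintegral_sinh {ρ : ℝ} (hρ : 0 < ρ) (f : ℝ → ENNReal) :
    ∫⁻ y, f y = ∫⁻ t, ENNReal.ofReal (ρ * cosh t) * f (-(ρ * sinh t)) := by
  have him : (fun t : ℝ => -(ρ * sinh t)) '' univ = univ := by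
    rw [image_univ, range_eq_univ]
    intro y
    obtain ⟨t, ht⟩ := sinh_surjective (-(y / ρ))
    exact ⟨t, by simp only [ht]; field_simp⟩
  rw [← setLIntegral_univ, ← him,
    lintegral_image_eq_lintegral_abs_deriv_mul (f' := fun t => -(ρ * cosh t)) MeasurableSet.univ
    (fun x _ => HasDerivAt.hasDerivWithinAt (f := fun t => -(ρ * sinh t))
      ((hasDerivAt_sinh x).const_mul ρ).neg)
    (fun x _ y _ h => by
      have := neg_injective h
      exact sinh_injective (mul_left_cancel₀ hρ.ne' this))]
  rw [setLIntegral_univ]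
  simp [abs_mul, abs_of_pos hρ, abs_of_pos (cosh_pos _)]

/-- Scaling of Euclidean space. -/
theorem lintegral_comp_smul_euc {m : ℕ} {a : ℝ} (ha : 0 < a) {f : Euc m → ENNReal}
    (hf : Measurable f) :
    ∫⁻ x, f x = ENNReal.ofReal (a ^ m) * ∫⁻ x, f (a • x) := by
  have h := Measure.map_addHaar_smul (volume : Measure (Euc m)) ha.ne'
  have h2 : ∫⁻ x, f (a • x) = ∫⁻ x, f x ∂(Measure.map (a • ·) (volume : Measure (Euc m))) := by
    rw [lintegral_map hf (by fun_prop)]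
  rw [h2, h, lintegral_smul_measure, smul_eq_mul, ← mul_assoc, ← ENNReal.ofReal_mul (by positivity)]
  have : a ^ m * |(a ^ Module.finrank ℝ (Euc m))⁻¹| = 1 := by
    rw [finrank_euclideanSpace_fin, abs_of_pos (by positivity)]
    field_simp
  rw [this]; simp

/-! ### Splitting off the vertical coordinate -/

/-- The point with vertical coordinate `h` and horizontal part `z`. -/
def cons {d : ℕ} (h : ℝ) (z : Euc d) : Euc (d + 1) :=
  WithLp.toLp 2 (Fin.cons h z.ofLp)

variable {d : ℕ}

lemma cons_zero (h : ℝ) (z : Euc d) : cons h z 0 = h := rfl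

lemma cons_add (h h' : ℝ) (z z' : Euc d) : cons h z + cons h' z' = cons (h + h') (z + z') := by
  ext i
  refine Fin.cases ?_ (fun j => ?_) i <;> simp [cons]

lemma smul_cons (a h : ℝ) (z : Euc d) : a • cons h z = cons (a * h) (a • z) := by
  ext i
  refine Fin.cases ?_ (fun j => ?_) i <;> simp [cons]

lemma vert_eq_cons : vert (d + 1) = cons 1 0 := by
  ext i
  refine Fin.cases ?_ (fun j => ?_) i <;> simp [cons, vert]

lemma norm_cons_sq (h : ℝ) (z : Euc d) : ‖cons h z‖ ^ 2 = h ^ 2 + ‖z‖ ^ 2 := by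
  simp [EuclideanSpace.norm_sq_eq, cons, Fin.sum_univ_succ]

@[fun_prop]
lemma continuous_cons : Continuous fun p : ℝ × Euc d => cons p.1 p.2 := by
  refine (PiLp.continuous_toLp 2 _).comp ?_
  refine continuous_pi fun i => ?_
  refine Fin.cases ?_ (fun j => ?_) i
  · simpa using continuous_fst
  · simp only [Fin.cons_succ]; fun_prop

@[fun_prop]
lemma Measurable.cons {α : Type*} [MeasurableSpace α] {f : α → ℝ} {g : α → Euc d}
    (hf : Measurable f) (hg : Measurable g) : Measurable fun a => cons (f a) (g a) :=
  continuous_cons.measurable.comp (hf.prodMk hg)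

theorem lintegral_cons {f : Euc (d + 1) → ENNReal} (hf : Measurable f) :
    ∫⁻ x, f x = ∫⁻ h, ∫⁻ z, f (cons h z) := by
  have h1 := PiLp.volume_preserving_toLp (Fin (d + 1))
  have h2 := (volume_preserving_piFinSuccAbove (fun _ : Fin (d + 1) => ℝ) 0).symm
  have h3 := PiLp.volume_preserving_ofLp (Fin d)
  rw [← h1.lintegral_comp hf, ← h2.lintegral_comp (f := fun a => f (WithLp.toLp 2 a)) (hf.comp h1.measurable),
    Measure.volume_eq_prod, lintegral_prod _ (by
      exact ((hf.comp h1.measurable).comp h2.measurable).aemeasurable)]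
  refine lintegral_congr fun h => ?_
  rw [← h3.lintegral_comp (by
    exact (hf.comp (h1.measurable.comp (h2.measurable.comp measurable_prodMk_left))))]
  refine lintegral_congr fun z => ?_
  congr 1
  ext i
  refine Fin.cases ?_ (fun j => ?_) i <;> simp [cons]

/-! ### Directions parametrized by the time since the highest point -/

/-- The unit vector at the time `t` of a geodesic that reaches its highest point at time `0`
in the horizontal direction `e`. -/
def tangentDir (t : ℝ) (e : Dir d) : Dir (d + 1) :=
  ⟨cons (-tanh t) ((cosh t)⁻¹ • (e : Euc d)), by
    rw [mem_sphere_zero_iff_norm, ← sq_eq_sq₀ (norm_nonneg _) zero_le_one, norm_cons_sq, norm_smul,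
      norm_dir, tanh_eq_sinh_div_cosh]
    have := (cosh_pos t).ne'
    simp only [norm_eq_abs, mul_one, sq_abs]
    field_simp
    linarith [cosh_sq t]⟩

lemma coe_tangentDir (t : ℝ) (e : Dir d) :
    (tangentDir t e : Euc (d + 1)) = cons (-tanh t) ((cosh t)⁻¹ • (e : Euc d)) := rfl

@[fun_prop]
lemma measurable_tanh : Measurable tanh := by
  have : tanh = fun x => sinh x / cosh x := funext tanh_eq_sinh_div_cosh
  rw [this]; fun_prop

@[fun_prop]
lemma Measurable.tangentDir {α : Type*} [MeasurableSpace α] {f : α → ℝ} {g : α → Dir d}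
    (hf : Measurable f) (hg : Measurable g) : Measurable fun a => tangentDir (f a) (g a) :=
  Measurable.subtype_mk (Measurable.cons (by fun_prop) (by fun_prop))

/-- Polar coordinates on the unit sphere about the vertical axis. -/
theorem lintegral_sphere_tangentDir (hd : d ≠ 0) {f : Dir (d + 1) → ENNReal} (hf : Measurable f) :
    ∫⁻ ω, f ω ∂(sphereVolume (d + 1)) = ∫⁻ e : Dir d, ∫⁻ t : ℝ,
      ENNReal.ofReal ((cosh t ^ d)⁻¹) * f (tangentDir t e) ∂volume ∂(sphereVolume d) := by
  have hemb : MeasurableEmbedding ((↑) : Dir (d + 1) → Euc (d + 1)) :=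
    MeasurableEmbedding.subtype_coe Metric.isClosed_sphere.measurableSet
  obtain ⟨F, hF, hFf⟩ : ∃ F : Euc (d + 1) → ENNReal, Measurable F ∧ ∀ ω : Dir (d + 1), F ω = f ω :=
    ⟨Function.extend (↑) f 0, hemb.measurable_extend hf measurable_zero,
      fun ω => hemb.injective.extend_apply _ _ _⟩
  -- A radial weight with `∫ r^d g(r) dr = 1`: the integral over the sphere becomes one over
  -- `ℝ^(d+1)`, which can be computed in polar coordinates and also in cylindrical ones.
  set g : ℝ → ENNReal := (Iio (1 : ℝ)).indicator fun r => ENNReal.ofReal ((r ^ d)⁻¹) with hg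
  have hgm : Measurable g := Measurable.indicator (by fun_prop) measurableSet_Iio
  have hK : ∫⁻ r in Ioi (0 : ℝ), ENNReal.ofReal (r ^ d) * g r = 1 := by
    have : ∀ r ∈ Ioi (0 : ℝ), ENNReal.ofReal (r ^ d) * g r = (Iio (1 : ℝ)).indicator 1 r := by
      intro r hr
      have hr' : 0 < r := hr
      by_cases h : r < 1
      · simp only [hg, indicator, mem_Iio, h, if_true, Pi.one_apply]
        rw [← ENNReal.ofReal_mul (by positivity), mul_inv_cancel₀ (by positivity)]
        simp
      · simp [hg, indicator, h]
    rw [setLIntegral_congr_fun measurableSet_Ioi this, lintegral_indicator_one measurableSet_Iio,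
      Measure.restrict_apply measurableSet_Iio, Iio_inter_Ioi]
    simp
  set G : Euc (d + 1) → ENNReal := fun y => F (‖y‖⁻¹ • y) * g ‖y‖ with hG
  have hGm : Measurable G := by
    refine Measurable.mul (hF.comp (by fun_prop)) (hgm.comp (by fun_prop))
  have h1 : ∫⁻ y, G y = ∫⁻ ω, f ω ∂(sphereVolume (d + 1)) := by
    rw [lintegral_polar (Nat.succ_ne_zero d) hGm]
    refine lintegral_congr fun ω => ?_
    have : ∀ r ∈ Ioi (0 : ℝ), ENNReal.ofReal (r ^ (d + 1 - 1)) * G (r • (ω : Euc (d + 1))) =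
        f ω * (ENNReal.ofReal (r ^ d) * g r) := by
      intro r hr
      have hr' : 0 < r := hr
      have hn : ‖r • (ω : Euc (d + 1))‖ = r := by simp [norm_smul, abs_of_pos hr']
      simp only [hG, hn, smul_smul, inv_mul_cancel₀ hr'.ne', one_smul, hFf, Nat.add_sub_cancel]
      ring
    rw [setLIntegral_congr_fun measurableSet_Ioi this,
      lintegral_const_mul _ (by fun_prop), hK, mul_one]
  have h2 : ∫⁻ y, G y = ∫⁻ e : Dir d, ∫⁻ t : ℝ,
      ENNReal.ofReal ((cosh t ^ d)⁻¹) * f (tangentDir t e) ∂volume ∂(sphereVolume d) := by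
    rw [lintegral_cons hGm, lintegral_lintegral_swap (f := fun h z => G (cons h z))
      (hGm.comp continuous_cons.measurable).aemeasurable]
    rw [lintegral_polar hd (Measurable.lintegral_prod_left (f := fun h z => G (cons h z))
      (hGm.comp continuous_cons.measurable))]
    refine lintegral_congr fun e => ?_
    have hrad : ∀ ρ ∈ Ioi (0 : ℝ), ENNReal.ofReal (ρ ^ (d - 1)) *
        ∫⁻ h, G (cons h (ρ • (e : Euc d))) =
        ∫⁻ t, f (tangentDir t e) * (ENNReal.ofReal (ρ ^ d * cosh t) * g (cosh t * ρ)) := by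
      intro ρ hρ
      have hρ' : 0 < ρ := hρ
      -- The point with height `-(ρ sinh t)` and horizontal part `ρ e` has norm `ρ cosh t` and
      -- direction `tangentDir t e`.
      rw [lintegral_eq_lintegral_sinh hρ', ← lintegral_const_mul' _ _ (by simp)]
      refine lintegral_congr fun t => ?_
      have hc := cosh_pos t
      have hn : ‖cons (-(ρ * sinh t)) (ρ • (e : Euc d))‖ = cosh t * ρ := by
        rw [← sq_eq_sq₀ (norm_nonneg _) (by positivity), norm_cons_sq, norm_smul, norm_dir]
        simp only [norm_eq_abs, mul_one, sq_abs]
        linear_combination - ρ ^ 2 * cosh_sq t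
      have hdir : (cosh t * ρ)⁻¹ • cons (-(ρ * sinh t)) (ρ • (e : Euc d)) = tangentDir t e := by
        rw [coe_tangentDir, smul_cons, smul_smul, tanh_eq_sinh_div_cosh]
        congr 1
        · field_simp
        · congr 1; field_simp
      simp only [hG, hn, hdir, hFf]
      have hp : ρ ^ d * cosh t = ρ ^ (d - 1) * (ρ * cosh t) := by
        obtain ⟨k, rfl⟩ := Nat.exists_eq_succ_of_ne_zero hd
        simp only [Nat.succ_eq_add_one, Nat.add_sub_cancel]
        ring
      rw [hp, ENNReal.ofReal_mul (p := ρ ^ (d - 1)) (by positivity)]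
      ring
    have hft : Measurable fun t : ℝ => f (tangentDir t e) :=
      hf.comp (Measurable.tangentDir measurable_id measurable_const)
    rw [setLIntegral_congr_fun measurableSet_Ioi hrad, lintegral_lintegral_swap (by
      refine Measurable.aemeasurable ?_
      refine Measurable.mul (hft.comp measurable_snd) ?_
      exact Measurable.mul (by fun_prop) (hgm.comp (by fun_prop)))]
    refine lintegral_congr fun t => ?_
    have hc := cosh_pos t
    rw [lintegral_const_mul _ (by fun_prop), mul_comm]
    congr 1
    have hscale : ∀ r ∈ Ioi (0 : ℝ), ENNReal.ofReal (cosh t)⁻¹ *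
        (ENNReal.ofReal (((cosh t)⁻¹ * r) ^ d * cosh t) * g (cosh t * ((cosh t)⁻¹ * r))) =
        ENNReal.ofReal (cosh t ^ d)⁻¹ * (ENNReal.ofReal (r ^ d) * g r) := by
      intro r hr
      have hr' : 0 < r := hr
      rw [mul_inv_cancel_left₀ hc.ne', ← mul_assoc, ← mul_assoc,
        ← ENNReal.ofReal_mul (inv_nonneg.2 hc.le), ← ENNReal.ofReal_mul (by positivity)]
      congr 2
      rw [mul_pow, inv_pow]
      field_simp
    rw [lintegral_Ioi_scale (inv_pos.2 hc), setLIntegral_congr_fun measurableSet_Ioi hscale,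
      lintegral_const_mul _ (by fun_prop), hK, mul_one]
  rw [← h1, h2]

/-! ### The vectors tangent to an arc between the two hyperplanes -/

/-- Since `tangentDir t e` is the direction of motion on the semicircle at time `t`, the geodesic
flow is the translation `t ↦ t + s` with `R`, `c`, `e` fixed. -/
lemma geodesic_tangentDir (R t s : ℝ) (c : Euc d) (e : Dir d) :
    geodesic (cons ((cosh t)⁻¹ * R) (c + (R * tanh t) • (e : Euc d))) (tangentDir t e) s =
      cons ((cosh (t + s))⁻¹ * R) (c + (R * tanh (t + s)) • (e : Euc d)) := by
  have h1 := cosh_pos t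
  have h2 := cosh_pos (t + s)
  have hq : cosh s - cons (-tanh t) ((cosh t)⁻¹ • (e : Euc d)) 0 * sinh s
      = cosh (t + s) / cosh t := by
    rw [cons_zero, tanh_eq_sinh_div_cosh, cosh_add]
    field_simp
    ring
  have hst : sinh s = sinh (t + s) * cosh t - cosh (t + s) * sinh t := by
    rw [sinh_add, cosh_add]
    linear_combination -sinh s * cosh_sq t
  have hct : cosh s = cosh (t + s) * cosh t - sinh (t + s) * sinh t := by
    rw [sinh_add, cosh_add]
    linear_combination -cosh s * cosh_sq t
  rw [geodesic, coe_tangentDir, hq, cons_zero, vert_eq_cons, smul_cons, smul_cons, cons_add,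
    smul_cons, cons_add, hst, hct]
  simp only [smul_zero, add_zero, tanh_eq_sinh_div_cosh]
  congr 1
  · have := cosh_sq t
    field_simp
    linear_combination (-R * cosh (t + s)) * this
  · rw [smul_smul, smul_smul, add_assoc, ← add_smul]
    congr 2
    field_simp
    ring

/-- Along a semicircle the squared norm is a weighted mean of its values at the endpoints, with
weights in the ratio `1 : exp (2 s)`. It is therefore monotone in `s`, and the times of crossing
depend on the two endpoint norms only. -/
lemma norm_sq_arc (R s : ℝ) (c : Euc d) (e : Dir d) :
    ‖cons ((cosh s)⁻¹ * R) (c + (R * tanh s) • (e : Euc d))‖ ^ 2 =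
      (‖c - R • (e : Euc d)‖ ^ 2 + ‖c + R • (e : Euc d)‖ ^ 2 * exp (2 * s)) / (1 + exp (2 * s)) := by
  have h1 := exp_pos s
  have h3 : (cosh s)⁻¹ = 2 * exp s / (1 + exp (2 * s)) := by
    rw [two_mul s, exp_add, cosh_eq, exp_neg]
    field_simp
    ring
  have h4 : tanh s = (exp (2 * s) - 1) / (1 + exp (2 * s)) := by
    rw [tanh_eq_sinh_div_cosh, sinh_eq, cosh_eq, exp_neg, two_mul s, exp_add]
    field_simp
    ring
  rw [norm_cons_sq, norm_add_sq_real, norm_sub_sq_real, norm_add_sq_real, norm_smul, norm_smul,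
    norm_dir, real_inner_smul_right, real_inner_smul_right, h3, h4]
  simp only [norm_eq_abs, mul_one, sq_abs]
  rw [two_mul s, exp_add]
  field_simp
  ring

/-- The length of the arc between the hemispheres of squared radii `1` and `s` on a geodesic whose
endpoints have squared norms `u < 1` and `v > s`. -/
def arcLength (s u v : ℝ) : ENNReal :=
  if u < 1 ∧ s < v then
    ENNReal.ofReal (log ((s - u) * (v - 1) / ((1 - u) * (v - s))) / 2) else 0

/-- For `u < y < v` the mean takes the value `y` exactly when `exp (2 a) = (y - u) / (v - y)`. The
admissible times form the interval between the solutions for `y = 1` and `y = s`. -/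
lemma volume_increasing_arc {s : ℝ} (hs : 1 < s) (u v : ℝ) :
    volume {t : ℝ | ∃ a ≤ t, ∃ b ≥ t, (u + v * exp (2 * a)) / (1 + exp (2 * a)) = 1 ∧
      (u + v * exp (2 * b)) / (1 + exp (2 * b)) = s} = arcLength s u v := by
  have hval : ∀ a y : ℝ, (u + v * exp (2 * a)) / (1 + exp (2 * a)) = y ↔
      (v - y) * exp (2 * a) = y - u := by
    intro a y
    have := exp_pos (2 * a)
    rw [div_eq_iff (by positivity)]
    constructor <;> intro h <;> linarith
  simp only [hval]
  by_cases h : u < 1 ∧ s < v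
  · obtain ⟨hu, hv⟩ := h
    have hlog : ∀ a y : ℝ, u < y → y < v → ((v - y) * exp (2 * a) = y - u ↔
        a = log ((y - u) / (v - y)) / 2) := by
      intro a y h1 h2
      have h3 : 0 < v - y := by linarith
      have h4 : 0 < y - u := by linarith
      rw [mul_comm, ← eq_div_iff h3.ne', eq_div_iff two_ne_zero, mul_comm a]
      constructor
      · intro h; rw [← h, log_exp]
      · intro h; rw [h, exp_log (by positivity)]
    simp only [hlog _ 1 hu (by linarith), hlog _ s (by linarith) hv]
    have : {t : ℝ | ∃ a ≤ t, ∃ b ≥ t, a = log ((1 - u) / (v - 1)) / 2 ∧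
        b = log ((s - u) / (v - s)) / 2} =
        Icc (log ((1 - u) / (v - 1)) / 2) (log ((s - u) / (v - s)) / 2) := by
      ext t
      constructor
      · rintro ⟨a, ha, b, hb, rfl, rfl⟩
        exact ⟨ha, hb⟩
      · rintro ⟨ha, hb⟩
        exact ⟨_, ha, _, hb, rfl, rfl⟩
    rw [this, volume_Icc, arcLength, if_pos ⟨hu, hv⟩]
    congr 1
    have h1 : 0 < 1 - u := by linarith
    have h2 : 0 < v - 1 := by linarith
    have h3 : 0 < s - u := by linarith
    have h4 : 0 < v - s := by linarith
    rw [← sub_div, ← log_div (by positivity) (by positivity)]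
    congr 2
    field_simp
  · rw [arcLength, if_neg h]
    convert measure_empty (μ := (volume : Measure ℝ))
    rw [eq_empty_iff_forall_notMem]
    -- The mean is monotone in time; as it is `1` at `a` and `s > 1` at the later time `b`, it
    -- increases from below `1` to above `s`.
    rintro t ⟨a, ha, b, hb, h1, h2⟩
    apply h
    have hw : exp (2 * a) ≤ exp (2 * b) := exp_le_exp.2 (by linarith)
    have hw0 := exp_pos (2 * a)
    have hv : s < v := by
      by_contra hv
      push Not at hv
      nlinarith
    exact ⟨by nlinarith, hv⟩

/-- Time reversal exchanges `u` and `v` and so reduces the decreasing order to the increasing one.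
At most one order has positive length, because `s > 1`; hence the union has the sum of the measures.
-/
lemma volume_arc {s : ℝ} (hs : 1 < s) (u v : ℝ) :
    volume {t : ℝ | ∃ a ≤ t, ∃ b ≥ t,
      ((u + v * exp (2 * a)) / (1 + exp (2 * a)) = 1 ∧
        (u + v * exp (2 * b)) / (1 + exp (2 * b)) = s) ∨
      ((u + v * exp (2 * a)) / (1 + exp (2 * a)) = s ∧
        (u + v * exp (2 * b)) / (1 + exp (2 * b)) = 1)} = arcLength s u v + arcLength s v u := by
  have h1 := volume_increasing_arc hs u v
  have h2 := volume_increasing_arc hs v u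
  set A := {t : ℝ | ∃ a ≤ t, ∃ b ≥ t, (u + v * exp (2 * a)) / (1 + exp (2 * a)) = 1 ∧
      (u + v * exp (2 * b)) / (1 + exp (2 * b)) = s}
  set B := {t : ℝ | ∃ a ≤ t, ∃ b ≥ t, (v + u * exp (2 * a)) / (1 + exp (2 * a)) = 1 ∧
      (v + u * exp (2 * b)) / (1 + exp (2 * b)) = s}
  have hneg : ∀ a : ℝ, (v + u * exp (2 * -a)) / (1 + exp (2 * -a)) =
      (u + v * exp (2 * a)) / (1 + exp (2 * a)) := by
    intro a
    rw [mul_neg, exp_neg]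
    field_simp
    ring
  have hB : volume (Neg.neg ⁻¹' B) = arcLength s v u := by
    rw [← h2]; exact Measure.measure_preimage_neg volume B
  have hset : {t : ℝ | ∃ a ≤ t, ∃ b ≥ t,
      ((u + v * exp (2 * a)) / (1 + exp (2 * a)) = 1 ∧
        (u + v * exp (2 * b)) / (1 + exp (2 * b)) = s) ∨
      ((u + v * exp (2 * a)) / (1 + exp (2 * a)) = s ∧
        (u + v * exp (2 * b)) / (1 + exp (2 * b)) = 1)} = A ∪ Neg.neg ⁻¹' B := by
    ext t
    constructor
    · rintro ⟨a, ha, b, hb, h | h⟩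
      · exact Or.inl ⟨a, ha, b, hb, h⟩
      · exact Or.inr ⟨-b, neg_le_neg hb, -a, neg_le_neg ha, by rw [hneg]; exact h.2,
          by rw [hneg]; exact h.1⟩
    · rintro (⟨a, ha, b, hb, h⟩ | ⟨a, ha, b, hb, h⟩)
      · exact ⟨a, ha, b, hb, Or.inl h⟩
      · exact ⟨-b, by linarith, -a, by linarith, Or.inr ⟨by rw [← hneg, neg_neg]; exact h.2,
          by rw [← hneg, neg_neg]; exact h.1⟩⟩
  rw [hset]
  by_cases h : u < 1 ∧ s < v
  · have h0 : arcLength s v u = 0 := if_neg fun h' => by linarith [h.1, h'.2]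
    rw [h0] at hB ⊢
    rw [add_zero, ← h1]
    exact le_antisymm ((measure_union_le _ _).trans (by rw [hB, add_zero]))
      (measure_mono subset_union_left)
  · have h0 : arcLength s u v = 0 := if_neg h
    rw [h0] at h1 ⊢
    rw [zero_add, ← hB]
    exact le_antisymm ((measure_union_le _ _).trans (by rw [h1, zero_add]))
      (measure_mono subset_union_right)

@[fun_prop]
lemma Measurable.arcLength {α : Type*} [MeasurableSpace α] {f g : α → ℝ} {s : ℝ}
    (hf : Measurable f) (hg : Measurable g) : Measurable fun a => arcLength s (f a) (g a) := by
  unfold BridgemanKahn.arcLength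
  refine Measurable.ite ?_ (by fun_prop) measurable_const
  exact (measurableSet_lt hf measurable_const).inter (measurableSet_lt measurable_const hg)

lemma continuous_geodesic (n : ℕ) [NeZero n] :
    Continuous fun p : (Euc n × Dir n) × ℝ => geodesic p.1.1 p.1.2 p.2 := by
  unfold geodesic
  have h : ∀ p : (Euc n × Dir n) × ℝ, cosh p.2 - (p.1.2 : Euc n) 0 * sinh p.2 ≠ 0 :=
    fun p => (denom_pos p.1.2 p.2).ne'
  fun_prop (disch := exact h)

/-- With the times confined to `[-k, 0]` and `[0, k]`, the crossing condition is closed and its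
projection along the compact factor is closed. The set is the union over `k`, cut down to the
half-space. Rescaling the times by `k` keeps the compact factor fixed. -/
lemma measurableSet_crossingVectors (n : ℕ) [NeZero n] (r s : ℝ) :
    MeasurableSet (crossingVectors (hyperplane n r) (hyperplane n s)) := by
  have hU : MeasurableSet {v : Euc n × Dir n | v.1 ∈ upperHalfSpace n} :=
    measurableSet_lt (f := fun _ : Euc n × Dir n => (0 : ℝ)) (g := fun v => v.1 0)
      measurable_const (by fun_prop)
  set C : ℕ → Set ((Euc n × Dir n) × (Icc (-1 : ℝ) 0 × Icc (0 : ℝ) 1)) := fun k =>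
    {p | (‖geodesic p.1.1 p.1.2 (k * p.2.1)‖ = exp r ∧ ‖geodesic p.1.1 p.1.2 (k * p.2.2)‖ = exp s) ∨
      (‖geodesic p.1.1 p.1.2 (k * p.2.1)‖ = exp s ∧ ‖geodesic p.1.1 p.1.2 (k * p.2.2)‖ = exp r)}
    with hC
  have hclosed : ∀ k, IsClosed (C k) := by
    intro k
    have h1 : Continuous fun p : (Euc n × Dir n) × (Icc (-1 : ℝ) 0 × Icc (0 : ℝ) 1) =>
        ‖geodesic p.1.1 p.1.2 (k * p.2.1)‖ :=
      ((continuous_geodesic n).comp (continuous_fst.prodMk (by fun_prop))).norm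
    have h2 : Continuous fun p : (Euc n × Dir n) × (Icc (-1 : ℝ) 0 × Icc (0 : ℝ) 1) =>
        ‖geodesic p.1.1 p.1.2 (k * p.2.2)‖ :=
      ((continuous_geodesic n).comp (continuous_fst.prodMk (by fun_prop))).norm
    exact ((isClosed_eq h1 continuous_const).inter (isClosed_eq h2 continuous_const)).union
      ((isClosed_eq h1 continuous_const).inter (isClosed_eq h2 continuous_const))
  have hset : crossingVectors (hyperplane n r) (hyperplane n s) =
      {v : Euc n × Dir n | v.1 ∈ upperHalfSpace n} ∩ ⋃ k, Prod.fst '' C k := by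
    ext v
    constructor
    · rintro ⟨hv, a, ha, b, hb, h⟩
      refine ⟨hv, mem_iUnion.2 ?_⟩
      obtain ⟨k, hk⟩ := exists_nat_gt (max (-a) b)
      have hka : -a < k := lt_of_le_of_lt (le_max_left _ _) hk
      have hkb : b < k := lt_of_le_of_lt (le_max_right _ _) hk
      have hk0 : (0 : ℝ) < k := lt_of_le_of_lt hb hkb
      refine ⟨k, (v, ⟨a / k, ?_, ?_⟩, ⟨b / k, ?_, ?_⟩), ?_, rfl⟩
      · rw [le_div_iff₀ hk0]; linarith
      · exact div_nonpos_of_nonpos_of_nonneg ha hk0.le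
      · positivity
      · rw [div_le_iff₀ hk0]; linarith
      · simp only [hC, mem_ofPred_eq, mul_div_cancel₀ _ hk0.ne']
        rcases h with h | h
        · exact Or.inl ⟨h.1.2, h.2.2⟩
        · exact Or.inr ⟨h.1.2, h.2.2⟩
    · rintro ⟨hv, h⟩
      obtain ⟨k, hk⟩ : ∃ k, v ∈ Prod.fst '' C k := mem_iUnion.1 h
      obtain ⟨⟨v', a, b⟩, hab, rfl⟩ := (mem_image _ _ _).1 hk
      refine ⟨hv, k * a, mul_nonpos_of_nonneg_of_nonpos (Nat.cast_nonneg _) a.2.2,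
        k * b, mul_nonneg (Nat.cast_nonneg _) b.2.1, ?_⟩
      rcases hab with h | h
      · exact Or.inl ⟨⟨geodesic_mem hv _ _, h.1⟩, ⟨geodesic_mem hv _ _, h.2⟩⟩
      · exact Or.inr ⟨⟨geodesic_mem hv _ _, h.1⟩, ⟨geodesic_mem hv _ _, h.2⟩⟩
  rw [hset]
  exact hU.inter (MeasurableSet.iUnion fun k =>
    (isClosedMap_fst_of_compactSpace _ (hclosed k)).measurableSet)

lemma mem_crossingVectors_iff {l R : ℝ} (hR : 0 < R) (t : ℝ) (c : Euc d) (e : Dir d) :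
    (cons ((cosh t)⁻¹ * R) (c + (R * tanh t) • (e : Euc d)), tangentDir t e) ∈
      crossingVectors (hyperplane (d + 1) 0) (hyperplane (d + 1) l) ↔
    t ∈ {t : ℝ | ∃ a ≤ t, ∃ b ≥ t,
      ((‖c - R • (e : Euc d)‖ ^ 2 + ‖c + R • (e : Euc d)‖ ^ 2 * exp (2 * a)) / (1 + exp (2 * a)) = 1 ∧
        (‖c - R • (e : Euc d)‖ ^ 2 + ‖c + R • (e : Euc d)‖ ^ 2 * exp (2 * b)) / (1 + exp (2 * b))
          = exp l ^ 2) ∨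
      ((‖c - R • (e : Euc d)‖ ^ 2 + ‖c + R • (e : Euc d)‖ ^ 2 * exp (2 * a)) / (1 + exp (2 * a))
          = exp l ^ 2 ∧
        (‖c - R • (e : Euc d)‖ ^ 2 + ‖c + R • (e : Euc d)‖ ^ 2 * exp (2 * b)) / (1 + exp (2 * b))
          = 1)} := by
  have hU : ∀ s, cons ((cosh s)⁻¹ * R) (c + (R * tanh s) • (e : Euc d)) ∈ upperHalfSpace (d + 1) :=
    fun s => mul_pos (inv_pos.2 (cosh_pos s)) hR
  have hmem : ∀ s r, geodesic (cons ((cosh t)⁻¹ * R) (c + (R * tanh t) • (e : Euc d)))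
      (tangentDir t e) s ∈ hyperplane (d + 1) r ↔
      (‖c - R • (e : Euc d)‖ ^ 2 + ‖c + R • (e : Euc d)‖ ^ 2 * exp (2 * (t + s))) /
        (1 + exp (2 * (t + s))) = exp r ^ 2 := by
    intro s r
    rw [geodesic_tangentDir, ← norm_sq_arc, sq_eq_sq₀ (norm_nonneg _) (exp_pos _).le]
    exact ⟨fun h => h.2, fun h => ⟨hU _, h⟩⟩
  simp only [crossingVectors, mem_ofPred_eq, hmem, exp_zero, one_pow]
  constructor
  · rintro ⟨-, a, ha, b, hb, h⟩
    exact ⟨t + a, by linarith, t + b, by linarith, h⟩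
  · rintro ⟨a, ha, b, hb, h⟩
    exact ⟨hU t, a - t, by linarith, b - t, by linarith, by
      simpa only [add_sub_cancel] using h⟩

/-! ### The crossing volume as an integral over pairs of boundary points -/

/-- With height `R / cosh t`, the powers of `cosh t` cancel: `-d` from the measure on directions,
`-1` from the change of height, `d + 1` from the hyperbolic density. The weight is then independent
of `t`, and the `t`-integral of the indicator is the time spent between the hemispheres. -/
theorem crossingVolume_eq_lintegral_arc (hd : d ≠ 0) {l : ℝ} (hl : 0 < l) :
    crossingVolume (d + 1) l = ∫⁻ e : Dir d, ∫⁻ R in Ioi (0 : ℝ), ∫⁻ c : Euc d,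
      ENNReal.ofReal ((R ^ (d + 1))⁻¹) *
        (arcLength (exp l ^ 2) (‖c - R • (e : Euc d)‖ ^ 2) (‖c + R • (e : Euc d)‖ ^ 2) +
          arcLength (exp l ^ 2) (‖c + R • (e : Euc d)‖ ^ 2) (‖c - R • (e : Euc d)‖ ^ 2))
      ∂volume ∂volume ∂(sphereVolume d) := by
  set V := crossingVectors (hyperplane (d + 1) 0) (hyperplane (d + 1) l) with hVdef
  have hV : MeasurableSet V := measurableSet_crossingVectors _ _ _
  have hs : 1 < exp l ^ 2 := one_lt_pow₀ (one_lt_exp_iff.2 hl) two_ne_zero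
  set I : Euc (d + 1) × Dir (d + 1) → ENNReal := V.indicator 1 with hI
  have hIm : Measurable I := measurable_one.indicator hV
  set f : Euc (d + 1) × Dir (d + 1) → ENNReal :=
    fun v => ENNReal.ofReal ((v.1 0 ^ (d + 1))⁻¹) * I v with hf
  have hfm : Measurable f := by fun_prop
  have hUm : MeasurableSet (upperHalfSpace (d + 1)) :=
    measurableSet_lt (f := fun _ : Euc (d + 1) => (0 : ℝ)) (g := fun x => x 0)
      measurable_const (by fun_prop)
  have hI0 : ∀ x ω, x ∉ upperHalfSpace (d + 1) → I (x, ω) = 0 := fun x ω hx =>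
    indicator_of_notMem (fun h => hx h.1) _
  have h1 : crossingVolume (d + 1) l =
      ∫⁻ ω, ∫⁻ x, f (x, ω) ∂volume ∂(sphereVolume (d + 1)) := by
    have : SFinite (sphereVolume (d + 1)) := by unfold sphereVolume; infer_instance
    have : SFinite (hypVolume (d + 1)) := by unfold hypVolume; infer_instance
    rw [crossingVolume, unitTangentVolume, Measure.prod_apply_symm hV]
    refine lintegral_congr fun ω => ?_
    have hm : Measurable fun x => I (x, ω) := hIm.comp (by fun_prop)
    have : hypVolume (d + 1) ((fun x => (x, ω)) ⁻¹' V) =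
        ∫⁻ x, I (x, ω) ∂(hypVolume (d + 1)) := by
      rw [← lintegral_indicator_one (hV.preimage (by fun_prop))]
      rfl
    rw [this, hypVolume, lintegral_withDensity_eq_lintegral_mul _ (by fun_prop) hm,
      ← lintegral_indicator hUm]
    refine lintegral_congr fun x => ?_
    by_cases hx : x ∈ upperHalfSpace (d + 1)
    · rw [indicator_of_mem hx]; rfl
    · rw [indicator_of_notMem hx]; simp [hf, hI0 x ω hx]
  have h2 : ∀ (t : ℝ) (e : Dir d), ENNReal.ofReal ((cosh t ^ d)⁻¹) *
      ∫⁻ x, f (x, tangentDir t e) = ∫⁻ R in Ioi (0 : ℝ), ∫⁻ c : Euc d,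
        ENNReal.ofReal ((R ^ (d + 1))⁻¹) *
          I (cons ((cosh t)⁻¹ * R) (c + (R * tanh t) • (e : Euc d)), tangentDir t e) := by
    intro t e
    have hc := cosh_pos t
    have hm : Measurable fun x => f (x, tangentDir t e) := hfm.comp (by fun_prop)
    have hz : ∀ h : ℝ, h ∉ Ioi 0 → ∫⁻ z : Euc d, f (cons h z, tangentDir t e) = 0 := by
      intro h hh
      rw [← lintegral_zero]
      refine lintegral_congr fun z => ?_
      have : cons h z ∉ upperHalfSpace (d + 1) := hh
      simp [hf, hI0 _ _ this]
    rw [lintegral_cons hm, ← setLIntegral_eq_of_support_subset (s := Ioi 0) (by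
      intro h hh
      by_contra h'
      exact hh (hz h h')), lintegral_Ioi_scale (inv_pos.2 hc), ← lintegral_const_mul]
    · refine setLIntegral_congr_fun measurableSet_Ioi fun R hR => ?_
      have hR' : 0 < R := hR
      -- The horizontal position is replaced by the centre of the semicircle, a translation for
      -- fixed `R`, `t`, `e`.
      rw [← lintegral_add_right_eq_self _ ((R * tanh t) • (e : Euc d)), ← mul_assoc,
        ← lintegral_const_mul]
      · refine lintegral_congr fun c => ?_
        simp only [hf, cons_zero]
        rw [← mul_assoc, ← ENNReal.ofReal_mul (by positivity), ← ENNReal.ofReal_mul (by positivity)]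
        congr 2
        rw [mul_pow, inv_pow, pow_succ (cosh t)]
        field_simp
      · exact hm.comp (by fun_prop)
    · refine Measurable.mul (by fun_prop) ?_
      exact Measurable.lintegral_prod_right' (f := fun p : ℝ × Euc d =>
        f (cons ((cosh t)⁻¹ * p.1) p.2, tangentDir t e)) (hm.comp (by fun_prop))
  have h3 : Measurable fun ω => ∫⁻ x, f (x, ω) := hfm.lintegral_prod_left'
  rw [h1, lintegral_sphere_tangentDir hd h3]
  refine lintegral_congr fun e => ?_
  simp only [h2]
  have hJ : Measurable fun p : (ℝ × ℝ) × Euc d => ENNReal.ofReal ((p.1.2 ^ (d + 1))⁻¹) *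
      I (cons ((cosh p.1.1)⁻¹ * p.1.2) (p.2 + (p.1.2 * tanh p.1.1) • (e : Euc d)),
        tangentDir p.1.1 e) := by
    refine Measurable.mul (by fun_prop) (hIm.comp (by fun_prop))
  rw [lintegral_lintegral_swap hJ.lintegral_prod_right'.aemeasurable]
  refine setLIntegral_congr_fun measurableSet_Ioi fun R hR => ?_
  have hR' : 0 < R := hR
  have hJR : Measurable fun q : ℝ × Euc d => ENNReal.ofReal ((R ^ (d + 1))⁻¹) *
      I (cons ((cosh q.1)⁻¹ * R) (q.2 + (R * tanh q.1) • (e : Euc d)), tangentDir q.1 e) :=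
    Measurable.const_mul (hIm.comp (by fun_prop)) _
  rw [lintegral_lintegral_swap hJR.aemeasurable]
  refine lintegral_congr fun c => ?_
  rw [lintegral_const_mul]
  · congr 1
    rw [← volume_arc hs, ← lintegral_indicator_one]
    · refine lintegral_congr fun t => ?_
      classical
      simp only [hI, indicator]
      exact if_congr (mem_crossingVectors_iff hR' t c e) rfl rfl
    · have : Measurable fun t => (cons ((cosh t)⁻¹ * R) (c + (R * tanh t) • (e : Euc d)),
        tangentDir t e) := by fun_prop
      exact (this hV).congr (Set.ext fun t => mem_crossingVectors_iff hR' t c e)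
  · exact hIm.comp (by fun_prop)

/-- The crossing volume as an integral over the pairs of endpoints of geodesics. -/
theorem crossingVolume_eq_lintegral_endpoints (hd : d ≠ 0) {l : ℝ} (hl : 0 < l) :
    crossingVolume (d + 1) l = ENNReal.ofReal (2 ^ (d + 1)) * ∫⁻ p : Euc d, ∫⁻ q : Euc d,
      ENNReal.ofReal ((‖q - p‖ ^ (2 * d))⁻¹) * arcLength (exp l ^ 2) (‖p‖ ^ 2) (‖q‖ ^ 2) := by
  rw [crossingVolume_eq_lintegral_arc hd hl]
  generalize exp l ^ 2 = s
  have hm1 : Measurable fun q : Euc d × Euc d => ENNReal.ofReal ((‖q.1‖ ^ (2 * d))⁻¹) *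
      arcLength s (‖q.2 - q.1‖ ^ 2) (‖q.2 + q.1‖ ^ 2) := by fun_prop
  set K : Euc d → ENNReal := fun w => ∫⁻ c : Euc d, ENNReal.ofReal ((‖w‖ ^ (2 * d))⁻¹) *
    arcLength s (‖c - w‖ ^ 2) (‖c + w‖ ^ 2) with hK
  have hKm : Measurable K := hm1.lintegral_prod_right'
  have hsplit : ∀ w : Euc d, ∫⁻ c : Euc d, ENNReal.ofReal ((‖w‖ ^ (2 * d))⁻¹) *
      (arcLength s (‖c - w‖ ^ 2) (‖c + w‖ ^ 2) + arcLength s (‖c + w‖ ^ 2) (‖c - w‖ ^ 2)) =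
      K w + K (-w) := by
    intro w
    simp only [hK, mul_add, norm_neg, sub_neg_eq_add, ← sub_eq_add_neg]
    rw [lintegral_add_left (by fun_prop)]
  -- Here `w = R e` is half the difference of the endpoints, and `R^(d-1) R^(-2d) = R^(-(d+1))`.
  have hpolar : ∫⁻ w, (K w + K (-w)) = ∫⁻ e : Dir d, ∫⁻ R in Ioi (0 : ℝ), ∫⁻ c : Euc d,
      ENNReal.ofReal ((R ^ (d + 1))⁻¹) *
        (arcLength s (‖c - R • (e : Euc d)‖ ^ 2) (‖c + R • (e : Euc d)‖ ^ 2) +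
          arcLength s (‖c + R • (e : Euc d)‖ ^ 2) (‖c - R • (e : Euc d)‖ ^ 2))
      ∂volume ∂volume ∂(sphereVolume d) := by
    rw [lintegral_polar hd (by fun_prop)]
    refine lintegral_congr fun e => ?_
    refine setLIntegral_congr_fun measurableSet_Ioi fun R hR => ?_
    have hR' : 0 < R := hR
    rw [← hsplit, ← lintegral_const_mul _ (by fun_prop)]
    refine lintegral_congr fun c => ?_
    rw [← mul_assoc, ← ENNReal.ofReal_mul (by positivity), norm_smul, norm_dir, norm_eq_abs,
      abs_of_pos hR', mul_one]
    congr 2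
    obtain ⟨k, rfl⟩ := Nat.exists_eq_succ_of_ne_zero hd
    simp only [Nat.succ_eq_add_one, Nat.add_sub_cancel]
    field_simp
    ring
  -- The two directions of travel contribute equally, by `w ↦ -w`: a factor `2`.
  rw [← hpolar, lintegral_add_left hKm, lintegral_neg_eq_self (f := K)]
  have htr : ∀ w, K w = ∫⁻ p : Euc d, ENNReal.ofReal ((‖w‖ ^ (2 * d))⁻¹) *
      arcLength s (‖p‖ ^ 2) (‖p + (2 : ℝ) • w‖ ^ 2) := by
    intro w
    rw [hK]
    simp only
    rw [← lintegral_add_right_eq_self _ w]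
    refine lintegral_congr fun c => ?_
    rw [add_sub_cancel_right, add_assoc, two_smul]
  have hm3 : Measurable fun q : Euc d × Euc d => ENNReal.ofReal ((‖q.1‖ ^ (2 * d))⁻¹) *
      arcLength s (‖q.2‖ ^ 2) (‖q.2 + (2 : ℝ) • q.1‖ ^ 2) := by fun_prop
  -- With `q - p = 2 w`, the kernel gives `2^(2d)` and the Jacobian `2^(-d)`.
  have hmain : ∫⁻ w, K w = ENNReal.ofReal (2 ^ d) * ∫⁻ p : Euc d, ∫⁻ q : Euc d,
      ENNReal.ofReal ((‖q - p‖ ^ (2 * d))⁻¹) * arcLength s (‖p‖ ^ 2) (‖q‖ ^ 2) := by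
    simp only [htr]
    have hm4 : Measurable fun q : Euc d × Euc d => ENNReal.ofReal ((‖q.2 - q.1‖ ^ (2 * d))⁻¹) *
      arcLength s (‖q.1‖ ^ 2) (‖q.2‖ ^ 2) := by fun_prop
    rw [lintegral_lintegral_swap hm3.aemeasurable, ← lintegral_const_mul _ hm4.lintegral_prod_right']
    refine lintegral_congr fun p => ?_
    rw [lintegral_comp_smul_euc (a := 1 / 2) (by norm_num) (by fun_prop),
      ← lintegral_sub_right_eq_self _ p, ← lintegral_const_mul _ (by fun_prop),
      ← lintegral_const_mul _ (by fun_prop)]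
    refine lintegral_congr fun w => ?_
    rw [smul_smul, ← mul_assoc, ← mul_assoc, ← ENNReal.ofReal_mul (by positivity),
      ← ENNReal.ofReal_mul (by positivity), norm_smul, mul_pow]
    have h1 : (2 : ℝ) * (1 / 2) = 1 := by norm_num
    have h2 : ‖(1 / 2 : ℝ)‖ = 1 / 2 := by norm_num
    rw [h1, h2, one_smul, add_sub_cancel]
    congr 2
    rw [mul_inv, ← mul_assoc, pow_mul, ← inv_pow, ← mul_pow]
    norm_num
  rw [hmain, pow_succ, ENNReal.ofReal_mul (by positivity)]
  simp only [ENNReal.ofReal_ofNat]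
  ring

/-! ### Integration by inversion in spheres -/

open EuclideanGeometry in
-- The derivative of the inversion is `(r / dist x c)^2` times a reflection, whose determinant is
-- `±1`.
theorem lintegral_inversion_image {c : Euc d} {r : ℝ} (hr : r ≠ 0) {S : Set (Euc d)}
    (hS : MeasurableSet S) (hc : c ∉ S) (f : Euc d → ENNReal) :
    ∫⁻ x in inversion c r '' S, f x =
      ∫⁻ x in S, ENNReal.ofReal ((r / dist x c) ^ (2 * d)) * f (inversion c r x) := by
  rw [lintegral_image_eq_lintegral_abs_det_fderiv_mul volume hS
    (fun x hx => (hasFDerivAt_inversion (R := r) (ne_of_mem_of_not_mem hx hc)).hasFDerivWithinAt)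
    (inversion_injective c hr).injOn]
  refine setLIntegral_congr_fun hS fun x hx => ?_
  congr 2
  have h1 : |LinearMap.det ((ℝ ∙ (x - c))ᗮ.reflection.toLinearMap)| = 1 := by
    rw [Submodule.det_reflection, abs_pow]; simp
  rw [ContinuousLinearMap.det, ContinuousLinearMap.toLinearMap_smul, LinearMap.det_smul, abs_mul]
  have h2 : |LinearMap.det (((ℝ ∙ (x - c))ᗮ.reflection : Euc d →L[ℝ] Euc d) : Euc d →ₗ[ℝ] Euc d)|
    = 1 := h1
  rw [h2, finrank_euclideanSpace_fin, mul_one, abs_of_nonneg (by positivity), pow_mul]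

lemma volume_ball_euc [Nontrivial (Euc d)] (x : Euc d) {r : ℝ} (hr : 0 ≤ r) :
    volume (Metric.ball x r) = ENNReal.ofReal (r ^ d) * volume (Metric.ball (0 : Euc d) 1) := by
  rw [Measure.addHaar_ball _ _ hr, finrank_euclideanSpace_fin]

open EuclideanGeometry in
lemma image_inversion_eq {c : Euc d} {S : Set (Euc d)} (hc : c ∉ S) :
    inversion c 1 '' S = {x | x ≠ c ∧ inversion c 1 x ∈ S} := by
  have hinv := inversion_involutive c (one_ne_zero (α := ℝ))
  ext x
  constructor
  · rintro ⟨y, hy, rfl⟩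
    refine ⟨fun h => hc ?_, by rwa [hinv]⟩
    rw [← hinv y, h, inversion_self] at hy
    exact hy
  · rintro ⟨-, hx⟩
    exact ⟨_, hx, hinv x⟩

open EuclideanGeometry in
lemma norm_sq_inversion (c x : Euc d) (hx : x ≠ c) :
    ‖inversion c 1 x‖ ^ 2 * ‖x - c‖ ^ 2 = ‖c‖ ^ 2 * ‖x - c‖ ^ 2 + 2 * inner ℝ (x - c) c + 1 := by
  have h : ‖x - c‖ ≠ 0 := norm_ne_zero_iff.2 (sub_ne_zero.2 hx)
  rw [inversion, vsub_eq_sub, vadd_eq_add, norm_add_sq_real, norm_smul, real_inner_smul_left,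
    dist_eq_norm]
  simp only [one_div, inv_pow, norm_inv, norm_pow, norm_norm]
  field_simp
  ring

open EuclideanGeometry in
/-- The integral of `|q - p|^(-2d)` over the exterior of a ball that contains `p`. -/
theorem lintegral_exterior_inv_dist [Nontrivial (Euc d)] {ρ : ℝ} (p : Euc d) (hp : ‖p‖ < ρ) :
    ∫⁻ q in {q : Euc d | ρ < ‖q‖}, ENNReal.ofReal ((‖q - p‖ ^ (2 * d))⁻¹) =
      ENNReal.ofReal ((ρ / (ρ ^ 2 - ‖p‖ ^ 2)) ^ d) * volume (Metric.ball (0 : Euc d) 1) := by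
  have hρ : 0 < ρ := (norm_nonneg p).trans_lt hp
  have hk : 0 < ρ ^ 2 - ‖p‖ ^ 2 := by nlinarith [norm_nonneg p]
  have hS : MeasurableSet {q : Euc d | ρ < ‖q‖} := measurableSet_lt measurable_const measurable_norm
  have hpS : p ∉ {q : Euc d | ρ < ‖q‖} := fun h => lt_asymm h hp
  -- The kernel is the Jacobian of the unit inversion about `p`, so the integral is the volume of
  -- the image of the exterior. That image is a ball without `p`, the image of infinity.
  have h := lintegral_inversion_image one_ne_zero hS hpS 1
  simp only [Pi.one_apply, mul_one, lintegral_one, Measure.restrict_apply MeasurableSet.univ,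
    univ_inter, dist_eq_norm, one_div, inv_pow] at h
  rw [← h, ← volume_ball_euc (p + (ρ ^ 2 - ‖p‖ ^ 2)⁻¹ • p) (by positivity),
    image_inversion_eq hpS]
  set k := ρ ^ 2 - ‖p‖ ^ 2 with hkdef
  have hset : {x | x ≠ p ∧ inversion p 1 x ∈ {q : Euc d | ρ < ‖q‖}} =
      Metric.ball (p + k⁻¹ • p) (ρ / k) \ {p} := by
    ext x
    rw [Set.mem_sdiff, mem_singleton_iff, and_comm, mem_ofPred_eq]
    refine and_congr_right fun hx => ?_
    have hn : 0 < ‖x - p‖ ^ 2 := by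
      have := norm_pos_iff.2 (sub_ne_zero.2 hx)
      positivity
    have e1 := norm_sq_inversion p x hx
    have e2 : ‖x - (p + k⁻¹ • p)‖ ^ 2 =
        ‖x - p‖ ^ 2 - 2 * (k⁻¹ * inner ℝ (x - p) p) + k⁻¹ ^ 2 * ‖p‖ ^ 2 := by
      rw [← sub_sub, norm_sub_sq_real, real_inner_smul_right, norm_smul, mul_pow, norm_eq_abs,
        sq_abs]
    rw [mem_ofPred_eq, Metric.mem_ball, dist_eq_norm, ← sq_lt_sq₀ hρ.le (norm_nonneg _),
      ← sq_lt_sq₀ (norm_nonneg _) (by positivity), e2, ← mul_lt_mul_iff_left₀ hn, e1]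
    have e3 : ‖p‖ ^ 2 = ρ ^ 2 - k := by rw [hkdef]; ring
    rw [e3]
    generalize inner ℝ (x - p) p = m
    generalize ‖x - p‖ ^ 2 = N
    have e4 : N - 2 * (k⁻¹ * m) + k⁻¹ ^ 2 * (ρ ^ 2 - k) - (ρ / k) ^ 2 = (k * N - 2 * m - 1) / k := by
      field_simp
      ring
    rw [← sub_neg (b := (ρ / k) ^ 2), e4, div_neg_iff]
    constructor
    · intro h; right; constructor <;> linarith
    · rintro (h | h) <;> linarith [h.1, h.2]
  rw [hset, measure_sdiff_null (measure_singleton _)]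

open EuclideanGeometry in
/-- The integral of `|p - q|^(-2d)` over a ball whose closure does not contain `q`. -/
theorem lintegral_ball_inv_dist [Nontrivial (Euc d)] {ρ : ℝ} (hρ : 0 < ρ) (q : Euc d) (hq : ρ < ‖q‖) :
    ∫⁻ p in {p : Euc d | ‖p‖ < ρ}, ENNReal.ofReal ((‖q - p‖ ^ (2 * d))⁻¹) =
      ENNReal.ofReal ((ρ / (‖q‖ ^ 2 - ρ ^ 2)) ^ d) * volume (Metric.ball (0 : Euc d) 1) := by
  have hk : 0 < ‖q‖ ^ 2 - ρ ^ 2 := by nlinarith [norm_nonneg q]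
  have hS : MeasurableSet {p : Euc d | ‖p‖ < ρ} := measurableSet_lt measurable_norm measurable_const
  have hqS : q ∉ {p : Euc d | ‖p‖ < ρ} := fun h => lt_asymm h hq
  have h := lintegral_inversion_image one_ne_zero hS hqS 1
  simp only [Pi.one_apply, mul_one, lintegral_one, Measure.restrict_apply MeasurableSet.univ,
    univ_inter, dist_eq_norm, one_div, inv_pow] at h
  simp only [norm_sub_rev q]
  rw [← h, ← volume_ball_euc (q - (‖q‖ ^ 2 - ρ ^ 2)⁻¹ • q) (by positivity),
    image_inversion_eq hqS]
  congr 1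
  set k := ‖q‖ ^ 2 - ρ ^ 2 with hkdef
  ext x
  have e3 : ‖q‖ ^ 2 = ρ ^ 2 + k := by rw [hkdef]; ring
  have e2 : ‖x - (q - k⁻¹ • q)‖ ^ 2 =
      ‖x - q‖ ^ 2 + 2 * (k⁻¹ * inner ℝ (x - q) q) + k⁻¹ ^ 2 * ‖q‖ ^ 2 := by
    rw [← sub_add, norm_add_sq_real, real_inner_smul_right, norm_smul, mul_pow, norm_eq_abs,
      sq_abs]
  rw [mem_ofPred_eq, mem_ofPred_eq, Metric.mem_ball, dist_eq_norm,
    ← sq_lt_sq₀ (norm_nonneg (x - _)) (by positivity), e2, ← sub_neg (b := (ρ / k) ^ 2)]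
  have e4 : ∀ N m : ℝ, N + 2 * (k⁻¹ * m) + k⁻¹ ^ 2 * ‖q‖ ^ 2 - (ρ / k) ^ 2 =
      (k * N + 2 * m + 1) / k := by
    intro N m
    rw [e3]
    field_simp
    ring
  rw [e4, div_neg_iff]
  -- The centre `q` of inversion lies outside the image ball, so no point has to be removed here.
  by_cases hx : x = q
  · subst hx
    simp only [ne_eq, not_true_eq_false, false_and, sub_self, norm_zero, inner_zero_left, false_iff]
    norm_num
    linarith
  · have hn : 0 < ‖x - q‖ ^ 2 := by
      have := norm_pos_iff.2 (sub_ne_zero.2 hx)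
      positivity
    have e1 := norm_sq_inversion q x hx
    rw [← sq_lt_sq₀ (norm_nonneg _) hρ.le, ← mul_lt_mul_iff_left₀ hn, e1, e3]
    constructor
    · intro h; right; constructor <;> linarith [h.2]
    · rintro (h | h)
      · linarith [h.1, h.2]
      · exact ⟨hx, by linarith [h.1]⟩

open EuclideanGeometry in
/-- The inversion that exchanges the unit ball and the exterior of the ball of radius `r`. -/
theorem lintegral_exterior_eq_lintegral_ball {r : ℝ} (hr : 0 < r) (h : ℝ → ENNReal) :
    ∫⁻ q in {q : Euc d | r < ‖q‖}, h ‖q‖ = ∫⁻ p in {p : Euc d | ‖p‖ < 1} \ {0},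
      ENNReal.ofReal ((r / ‖p‖ ^ 2) ^ d) * h (r / ‖p‖) := by
  have hS : MeasurableSet ({p : Euc d | ‖p‖ < 1} \ {0}) :=
    (measurableSet_lt measurable_norm measurable_const).diff (measurableSet_singleton _)
  have hsq : √r ^ 2 = r := sq_sqrt hr.le
  -- Inversion of radius `√r` sends norm `ρ` to `r / ρ`.
  have hs0 : √r ≠ 0 := (sqrt_pos.2 hr).ne'
  have hnorm : ∀ x : Euc d, ‖inversion 0 (√r) x‖ = r / ‖x‖ := fun x => by
    rw [← dist_zero_right, dist_inversion_center, dist_zero_right, hsq]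
  have him : inversion (0 : Euc d) (√r) '' ({p : Euc d | ‖p‖ < 1} \ {0}) = {q : Euc d | r < ‖q‖} := by
    have hinv := inversion_involutive (0 : Euc d) hs0
    ext x
    constructor
    · rintro ⟨y, ⟨hy, hy0⟩, rfl⟩
      rw [mem_ofPred_eq, hnorm, lt_div_iff₀ (norm_pos_iff.2 hy0)]
      have : ‖y‖ < 1 := hy
      nlinarith
    · intro hx
      have hx' : r < ‖x‖ := hx
      have hxn : 0 < ‖x‖ := hr.trans hx'
      refine ⟨_, ⟨?_, fun h0 => ?_⟩, hinv x⟩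
      · rw [mem_ofPred_eq, hnorm, div_lt_one hxn]; exact hx'
      · have := hnorm x
        rw [mem_singleton_iff.1 h0, norm_zero] at this
        exact (div_pos hr hxn).ne this
  rw [← him, lintegral_inversion_image hs0 hS (by simp)]
  refine setLIntegral_congr_fun hS fun x hx => ?_
  rw [hnorm, dist_zero_right, pow_mul, div_pow, hsq]

/-! ### The crossing volume as a one-dimensional integral -/

lemma log_profile_nonneg {E ρ : ℝ} (hE : 1 < E) (h0 : 0 ≤ ρ) (h1 : ρ < 1) :
    0 ≤ log ((E ^ 2 - ρ ^ 2) / (E * (1 - ρ ^ 2))) := by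
  have h2 : 0 < 1 - ρ ^ 2 := by nlinarith
  refine log_nonneg ?_
  rw [le_div_iff₀ (by positivity)]
  nlinarith [mul_nonneg (mul_nonneg (sub_nonneg.2 hE.le) h0) h0]

/-- The cross ratio is a function of `u` times a function of `v`. Moving a factor `E` between them
makes both the same profile, evaluated at `u` and at `E / v`; both logarithms are then nonnegative,
so the splitting holds in `ENNReal`. -/
lemma arcLength_eq_add {E u v : ℝ} (hE : 1 < E) (hu0 : 0 ≤ u) (hu : u < 1) (hv : E < v) :
    arcLength (E ^ 2) (u ^ 2) (v ^ 2) =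
      ENNReal.ofReal (log ((E ^ 2 - u ^ 2) / (E * (1 - u ^ 2))) / 2) +
      ENNReal.ofReal (log ((E ^ 2 - (E / v) ^ 2) / (E * (1 - (E / v) ^ 2))) / 2) := by
  have hv0 : 0 < v := by linarith
  have h1 : 0 < 1 - u ^ 2 := by nlinarith
  have h2 : 0 < E ^ 2 - u ^ 2 := by nlinarith
  have h3 : 0 < v ^ 2 - E ^ 2 := by nlinarith
  have h4 : 0 < v ^ 2 - 1 := by nlinarith
  have hd1 : E / v < 1 := (div_lt_one hv0).2 hv
  have hd0 : 0 ≤ E / v := by positivity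
  have h5 : 0 < 1 - (E / v) ^ 2 := by nlinarith
  have h6 : 0 < E ^ 2 - (E / v) ^ 2 := by nlinarith
  rw [arcLength, if_pos ⟨by linarith, by linarith⟩, ← ENNReal.ofReal_add
    (div_nonneg (log_profile_nonneg hE hu0 hu) zero_le_two)
    (div_nonneg (log_profile_nonneg hE hd0 hd1) zero_le_two), ← add_div,
    ← log_mul (by positivity) (by positivity)]
  congr 3
  have e1 : 1 - (E / v) ^ 2 = (v ^ 2 - E ^ 2) / v ^ 2 := by field_simp
  have e2 : E ^ 2 - (E / v) ^ 2 = E ^ 2 * (v ^ 2 - 1) / v ^ 2 := by field_simp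
  rw [e1, e2]
  field_simp

/-- The crossing volume as an integral over the unit ball. -/
theorem crossingVolume_eq_lintegral_ball (hd : d ≠ 0) {l : ℝ} (hl : 0 < l) :
    crossingVolume (d + 1) l = ENNReal.ofReal (2 ^ (d + 1)) *
      (volume (Metric.ball (0 : Euc d) 1) * ∫⁻ p in {p : Euc d | ‖p‖ < 1},
        ENNReal.ofReal ((exp l / (exp l ^ 2 - ‖p‖ ^ 2)) ^ d *
          log ((exp l ^ 2 - ‖p‖ ^ 2) / (exp l * (1 - ‖p‖ ^ 2))))) := by
  have : Nontrivial (Euc d) := by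
    have := Fin.pos_iff_nonempty.1 (Nat.pos_of_ne_zero hd)
    infer_instance
  rw [crossingVolume_eq_lintegral_endpoints hd hl]
  congr 1
  have hE : 1 < exp l := one_lt_exp_iff.2 hl
  generalize exp l = E at hE ⊢
  set A : ℝ → ENNReal :=
    fun ρ => ENNReal.ofReal (log ((E ^ 2 - ρ ^ 2) / (E * (1 - ρ ^ 2))) / 2) with hA
  have hAm : Measurable A := by fun_prop
  set ω := volume (Metric.ball (0 : Euc d) 1) with hω
  have hSm : MeasurableSet {p : Euc d | ‖p‖ < 1} := measurableSet_lt measurable_norm measurable_const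
  have hTm : MeasurableSet {q : Euc d | E < ‖q‖} := measurableSet_lt measurable_const measurable_norm
  set k : Euc d → Euc d → ENNReal := fun p q => ENNReal.ofReal ((‖q - p‖ ^ (2 * d))⁻¹) with hk
  have hkm : Measurable (Function.uncurry k) := by
    show Measurable fun x : Euc d × Euc d => ENNReal.ofReal ((‖x.2 - x.1‖ ^ (2 * d))⁻¹)
    fun_prop
  have hkm1 : ∀ p, Measurable (k p) := fun p => by fun_prop
  have hkm2 : ∀ q, Measurable fun p => k p q := fun p => by fun_prop
  have h1 : ∫⁻ p : Euc d, ∫⁻ q : Euc d, k p q * arcLength (E ^ 2) (‖p‖ ^ 2) (‖q‖ ^ 2) =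
      ∫⁻ p in {p : Euc d | ‖p‖ < 1}, ∫⁻ q in {q : Euc d | E < ‖q‖},
        (k p q * A ‖p‖ + k p q * A (E / ‖q‖)) := by
    rw [← lintegral_indicator hSm]
    refine lintegral_congr fun p => ?_
    by_cases hp : ‖p‖ < 1
    · rw [indicator_of_mem (by exact hp), ← lintegral_indicator hTm]
      refine lintegral_congr fun q => ?_
      by_cases hq : E < ‖q‖
      · rw [indicator_of_mem (by exact hq), arcLength_eq_add hE (norm_nonneg p) hp hq, mul_add]
      · rw [indicator_of_notMem (by exact hq), arcLength, if_neg, mul_zero]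
        rw [sq_lt_sq₀ (by linarith) (norm_nonneg _)]
        exact fun h => hq h.2
    · rw [indicator_of_notMem (by exact hp), ← lintegral_zero]
      refine lintegral_congr fun q => ?_
      rw [arcLength, if_neg, mul_zero]
      rw [sq_lt_one_iff₀ (norm_nonneg _)]
      exact fun h => hp h.1
  set B : ℝ → ENNReal := fun ρ => ENNReal.ofReal ((E / (E ^ 2 - ρ ^ 2)) ^ d) with hB
  have hBm : Measurable B := by fun_prop
  have h2 : ∫⁻ p in {p : Euc d | ‖p‖ < 1}, ∫⁻ q in {q : Euc d | E < ‖q‖}, k p q * A ‖p‖ =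
      ω * ∫⁻ p in {p : Euc d | ‖p‖ < 1}, B ‖p‖ * A ‖p‖ := by
    rw [← lintegral_const_mul _ (by fun_prop)]
    refine setLIntegral_congr_fun hSm fun p hp => ?_
    have hp' : ‖p‖ < 1 := hp
    rw [lintegral_mul_const _ (hkm1 p), lintegral_exterior_inv_dist p (hp'.trans hE)]
    ring
  -- Integrating out `p` first leaves an integral over the exterior; the inversion of radius `√E`
  -- carries it to the same ball integral as in `h2`.
  have h3 : ∫⁻ p in {p : Euc d | ‖p‖ < 1}, ∫⁻ q in {q : Euc d | E < ‖q‖}, k p q * A (E / ‖q‖) =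
      ω * ∫⁻ p in {p : Euc d | ‖p‖ < 1}, B ‖p‖ * A ‖p‖ := by
    have hm : Measurable (Function.uncurry fun p q : Euc d => k p q * A (E / ‖q‖)) :=
      hkm.mul (hAm.comp (by fun_prop))
    rw [lintegral_lintegral_swap hm.aemeasurable]
    have hq : ∀ q ∈ {q : Euc d | E < ‖q‖}, ∫⁻ p in {p : Euc d | ‖p‖ < 1}, k p q * A (E / ‖q‖) =
        ω * (ENNReal.ofReal ((1 / (‖q‖ ^ 2 - 1 ^ 2)) ^ d) * A (E / ‖q‖)) := by
      intro q hq
      have hq' : E < ‖q‖ := hq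
      rw [lintegral_mul_const _ (hkm2 q), lintegral_ball_inv_dist one_pos q (hE.trans hq')]
      ring
    rw [setLIntegral_congr_fun hTm hq, lintegral_const_mul _ (by fun_prop)]
    congr 1
    rw [lintegral_exterior_eq_lintegral_ball (by linarith)
      (fun ρ => ENNReal.ofReal ((1 / (ρ ^ 2 - 1 ^ 2)) ^ d) * A (E / ρ))]
    rw [setLIntegral_congr (s := {p : Euc d | ‖p‖ < 1}) (sdiff_null_ae_eq_self
      (measure_singleton (0 : Euc d))).symm]
    refine setLIntegral_congr_fun (hSm.diff (measurableSet_singleton _)) fun p hp => ?_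
    have hp0 : 0 < ‖p‖ := norm_pos_iff.2 hp.2
    have hp1 : ‖p‖ < 1 := hp.1
    have hE0 : 0 < E := by linarith
    simp only [hB]
    rw [← mul_assoc, ← ENNReal.ofReal_mul (by positivity), ← mul_pow, div_div_cancel₀ hE0.ne']
    congr 3
    have : E ^ 2 - ‖p‖ ^ 2 ≠ 0 := by nlinarith
    field_simp
  have h4 : ∫⁻ p in {p : Euc d | ‖p‖ < 1}, ENNReal.ofReal ((E / (E ^ 2 - ‖p‖ ^ 2)) ^ d *
      log ((E ^ 2 - ‖p‖ ^ 2) / (E * (1 - ‖p‖ ^ 2)))) =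
      ∫⁻ p in {p : Euc d | ‖p‖ < 1}, (B ‖p‖ * A ‖p‖ + B ‖p‖ * A ‖p‖) := by
    refine setLIntegral_congr_fun hSm fun p hp => ?_
    have hp1 : ‖p‖ < 1 := hp
    have hn := log_profile_nonneg hE (norm_nonneg p) hp1
    have hE2 : 0 < E ^ 2 - ‖p‖ ^ 2 := by nlinarith [norm_nonneg p]
    have hE0 : 0 < E := by linarith
    simp only [hA, hB]
    rw [← mul_add, ← ENNReal.ofReal_add (by positivity) (by positivity), add_halves,
      ENNReal.ofReal_mul (by positivity)]
  have hkA : Measurable fun p => ∫⁻ q in {q : Euc d | E < ‖q‖}, k p q * A ‖p‖ := by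
    have hm : Measurable (Function.uncurry fun p q : Euc d => k p q * A ‖p‖) :=
      hkm.mul (hAm.comp (by fun_prop))
    exact hm.lintegral_prod_right
  have h5 : ∀ p, ∫⁻ q in {q : Euc d | E < ‖q‖}, (k p q * A ‖p‖ + k p q * A (E / ‖q‖)) =
      (∫⁻ q in {q : Euc d | E < ‖q‖}, k p q * A ‖p‖) +
        ∫⁻ q in {q : Euc d | E < ‖q‖}, k p q * A (E / ‖q‖) :=
    fun p => lintegral_add_left ((hkm1 p).mul_const _) _
  rw [h1, h4]
  simp only [h5]
  rw [lintegral_add_left hkA, h2, h3, lintegral_add_left (by fun_prop), mul_add]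

lemma lintegral_unitBall_radial (hd : d ≠ 0) {h : ℝ → ENNReal} (hh : Measurable h) :
    ∫⁻ p in {p : Euc d | ‖p‖ < 1}, h ‖p‖ =
      sphereVolume d univ * ∫⁻ ρ in Ioo (0 : ℝ) 1, ENNReal.ofReal (ρ ^ (d - 1)) * h ρ := by
  have hSm : MeasurableSet {p : Euc d | ‖p‖ < 1} := measurableSet_lt measurable_norm measurable_const
  have h1 : ∀ p : Euc d, {p : Euc d | ‖p‖ < 1}.indicator (fun p => h ‖p‖) p =
      (Iio (1 : ℝ)).indicator h ‖p‖ := fun p => by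
    simp [indicator]
  have hm : Measurable ((Iio (1 : ℝ)).indicator h) := hh.indicator measurableSet_Iio
  rw [← lintegral_indicator hSm, lintegral_congr h1, lintegral_polar hd (by fun_prop)]
  have h2 : ∀ ω : Dir d, ∫⁻ r in Ioi (0 : ℝ), ENNReal.ofReal (r ^ (d - 1)) *
      (Iio (1 : ℝ)).indicator h ‖r • (ω : Euc d)‖ =
      ∫⁻ ρ in Ioo (0 : ℝ) 1, ENNReal.ofReal (ρ ^ (d - 1)) * h ρ := by
    intro ω
    rw [← lintegral_indicator measurableSet_Ioi, ← lintegral_indicator measurableSet_Ioo]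
    refine lintegral_congr fun r => ?_
    by_cases hr : 0 < r
    · by_cases hr1 : r < 1 <;> simp [indicator, norm_smul, hr, hr1, abs_of_pos hr]
    · simp [indicator, hr]
  simp only [h2, lintegral_const]
  ring

/-- The crossing volume as a one-dimensional integral. -/
theorem crossingVolume_eq_lintegral_radial (hd : d ≠ 0) {l : ℝ} (hl : 0 < l) :
    crossingVolume (d + 1) l = ENNReal.ofReal (2 ^ (d + 1)) *
      (volume (Metric.ball (0 : Euc d) 1) * (sphereVolume d univ * ∫⁻ ρ in Ioo (0 : ℝ) 1,
        ENNReal.ofReal (ρ ^ (d - 1) * ((exp l / (exp l ^ 2 - ρ ^ 2)) ^ d *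
          log ((exp l ^ 2 - ρ ^ 2) / (exp l * (1 - ρ ^ 2))))))) := by
  rw [crossingVolume_eq_lintegral_ball hd hl, lintegral_unitBall_radial hd
    (h := fun ρ => ENNReal.ofReal ((exp l / (exp l ^ 2 - ρ ^ 2)) ^ d *
          log ((exp l ^ 2 - ρ ^ 2) / (exp l * (1 - ρ ^ 2))))) (by fun_prop)]
  congr 3
  refine setLIntegral_congr_fun measurableSet_Ioo fun ρ hρ => ?_
  have h0 : 0 ≤ ρ := hρ.1.le
  rw [ENNReal.ofReal_mul (p := ρ ^ (d - 1)) (by positivity)]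

/-! ### Asymptotics of the one-dimensional integral -/

/-- This geometric sum cancels the rational term that appears when `(1 - (1 + a)^(-m)) log ((1 +
a)/a)` is differentiated. -/
lemma sum_inv_pow_eq (m : ℕ) {a : ℝ} (ha : 0 < a) :
    ∑ k ∈ Finset.range m, ((1 + a) ^ (k + 2))⁻¹ = (1 - ((1 + a) ^ m)⁻¹) / (a * (1 + a)) := by
  induction m with
  | zero => simp
  | succ m ih =>
    rw [Finset.sum_range_succ, ih]
    have : 0 < 1 + a := by linarith
    field_simp
    ring

/-- A primitive of `a ↦ (1 + a)^(-(m+1)) log (1 + 1/a)`, up to the factor `m`. -/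
lemma hasDerivAt_harmonic_primitive (m : ℕ) {a : ℝ} (ha : 0 < a) :
    HasDerivAt (fun a : ℝ => (1 - ((1 + a) ^ m)⁻¹) * log ((1 + a) / a) -
      ∑ k ∈ Finset.range m, ((1 + a) ^ (k + 1))⁻¹ / (k + 1))
      (m * (((1 + a) ^ (m + 1))⁻¹ * log ((1 + a) / a))) a := by
  have h0 : 0 < 1 + a := by linarith
  have hbase : HasDerivAt (fun a : ℝ => 1 + a) 1 a := (hasDerivAt_id a).const_add 1
  have hpow : ∀ k : ℕ, HasDerivAt (fun a : ℝ => ((1 + a) ^ k)⁻¹) (-(k * ((1 + a) ^ (k + 1))⁻¹)) a := by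
    intro k
    refine ((hbase.pow k).inv (pow_pos h0 k).ne').congr_deriv ?_
    rcases k with _ | k
    · simp
    · simp only [Nat.add_sub_cancel, mul_one, Pi.pow_apply]
      field_simp
      ring
  have hlog : HasDerivAt (fun a : ℝ => log ((1 + a) / a)) (-(a * (1 + a))⁻¹) a := by
    refine ((hbase.div (hasDerivAt_id a) ha.ne').log (by simp; constructor <;> positivity)).congr_deriv ?_
    simp only [id, Pi.div_apply]
    field_simp
    ring
  have hsum : HasDerivAt (fun a : ℝ => ∑ k ∈ Finset.range m, ((1 + a) ^ (k + 1))⁻¹ / (k + 1))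
      (∑ k ∈ Finset.range m, -((1 + a) ^ (k + 2))⁻¹) a := by
    refine HasDerivAt.fun_sum fun k _ => ?_
    refine ((hpow (k + 1)).div_const _).congr_deriv ?_
    push_cast
    field_simp
  refine ((((hpow m).const_sub 1).mul hlog).sub hsum).congr_deriv ?_
  rw [Finset.sum_neg_distrib, sum_inv_pow_eq m ha]
  field_simp
  ring

lemma log_ratio_nonneg {a : ℝ} (ha : 0 < a) : 0 ≤ log ((1 + a) / a) :=
  log_nonneg (by rw [le_div_iff₀ ha]; linarith)

lemma log_ratio_le {a : ℝ} (ha : 0 < a) : log ((1 + a) / a) ≤ a⁻¹ := by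
  have := log_le_sub_one_of_pos (show 0 < (1 + a) / a by positivity)
  refine this.trans (le_of_eq ?_)
  field_simp
  ring

lemma sum_inv_eq_harmonic (m : ℕ) :
    ∑ k ∈ Finset.range m, (1 : ℝ) / (k + 1) = (harmonic m : ℝ) := by
  rw [harmonic]
  push_cast
  simp [one_div]

/-- The primitive of `hasDerivAt_harmonic_primitive` rises from `-H(m)` at `0` to `0` at infinity.
-/
theorem lintegral_harmonic {m : ℕ} (hm : m ≠ 0) :
    ∫⁻ a in Ioi (0 : ℝ), ENNReal.ofReal (((1 + a) ^ (m + 1))⁻¹ * log ((1 + a) / a)) =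
      ENNReal.ofReal ((harmonic m : ℝ) / m) := by
  have hm0 : (0 : ℝ) < m := Nat.cast_pos.2 (Nat.pos_of_ne_zero hm)
  set Φ : ℝ → ℝ := fun a => (1 - ((1 + a) ^ m)⁻¹) * log ((1 + a) / a) -
      ∑ k ∈ Finset.range m, ((1 + a) ^ (k + 1))⁻¹ / (k + 1) with hΦ
  have hsumc : Tendsto (fun a : ℝ => ∑ k ∈ Finset.range m, ((1 + a) ^ (k + 1))⁻¹ / ((k : ℝ) + 1))
      (𝓝 0) (𝓝 (harmonic m : ℝ)) := by
    rw [← sum_inv_eq_harmonic]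
    refine tendsto_finsetSum _ fun k _ => ?_
    have : ContinuousAt (fun a : ℝ => ((1 + a) ^ (k + 1))⁻¹ / ((k : ℝ) + 1)) 0 := by
      refine ContinuousAt.div_const (ContinuousAt.inv₀ (by fun_prop) (by simp)) _
    simpa [ContinuousAt] using this
  have hzero : Tendsto (fun a : ℝ => (1 - ((1 + a) ^ m)⁻¹) * log ((1 + a) / a)) (𝓝[>] 0) (𝓝 0) := by
    have hb : Tendsto (fun a : ℝ => m * (a * log (1 + a) - log a * a)) (𝓝[>] 0) (𝓝 0) := by
      have h1 : Tendsto (fun a : ℝ => a * log (1 + a)) (𝓝[>] 0) (𝓝 0) := by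
        have : ContinuousAt (fun a : ℝ => a * log (1 + a)) 0 :=
          continuousAt_id.mul (ContinuousAt.log (by fun_prop) (by simp))
        simpa [ContinuousAt] using this.tendsto.mono_left nhdsWithin_le_nhds
      have h2 : Tendsto (fun a : ℝ => log a * a) (𝓝[>] 0) (𝓝 0) := by
        simpa only [rpow_one] using tendsto_log_mul_rpow_nhdsGT_zero zero_lt_one
      simpa using (h1.sub h2).const_mul (m : ℝ)
    refine squeeze_zero' ?_ ?_ hb
    · filter_upwards [self_mem_nhdsWithin] with a ha
      have ha' : 0 < a := ha
      have : ((1 + a) ^ m)⁻¹ ≤ 1 := inv_le_one_of_one_le₀ (one_le_pow₀ (by linarith))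
      exact mul_nonneg (by linarith) (log_ratio_nonneg ha')
    · filter_upwards [self_mem_nhdsWithin] with a ha
      have ha' : 0 < a := ha
      have h1a : 0 < 1 + a := by linarith
      have hB : 1 - ((1 + a) ^ m)⁻¹ ≤ m * a := by
        -- Bernoulli's inequality for `(1 + a)⁻¹ = 1 - a/(1 + a)`. The factor `m a` so obtained
        -- beats the logarithmic singularity at `0`.
        have h3 := one_add_mul_le_pow (show (-2 : ℝ) ≤ -(a / (1 + a)) by
          have : a / (1 + a) ≤ 1 := by rw [div_le_one h1a]; linarith
          linarith) m
        have h4 : 1 + -(a / (1 + a)) = (1 + a)⁻¹ := by field_simp; ring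
        rw [h4, inv_pow] at h3
        have h5 : a / (1 + a) ≤ a := div_le_self ha'.le (by linarith)
        nlinarith
      calc (1 - ((1 + a) ^ m)⁻¹) * log ((1 + a) / a) ≤ m * a * log ((1 + a) / a) :=
            mul_le_mul_of_nonneg_right hB (log_ratio_nonneg ha')
        _ = _ := by rw [log_div h1a.ne' ha'.ne']; ring
  have hΦ0 : Tendsto Φ (𝓝[>] 0) (𝓝 (-(harmonic m : ℝ))) := by
    simpa using hzero.sub (hsumc.mono_left nhdsWithin_le_nhds)
  have hΦinf : Tendsto Φ atTop (𝓝 0) := by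
    have hpow : ∀ k : ℕ, k ≠ 0 → Tendsto (fun a : ℝ => ((1 + a) ^ k)⁻¹) atTop (𝓝 0) := fun k hk =>
      ((tendsto_pow_atTop hk).comp (tendsto_atTop_add_const_left _ 1 tendsto_id)).inv_tendsto_atTop
    have h1 : Tendsto (fun a : ℝ => log ((1 + a) / a)) atTop (𝓝 0) := by
      refine squeeze_zero' ?_ ?_ tendsto_inv_atTop_zero
      · filter_upwards [eventually_gt_atTop 0] with a ha using log_ratio_nonneg ha
      · filter_upwards [eventually_gt_atTop 0] with a ha using log_ratio_le ha
    have h2 : Tendsto (fun a : ℝ => ∑ k ∈ Finset.range m, ((1 + a) ^ (k + 1))⁻¹ / ((k : ℝ) + 1))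
        atTop (𝓝 (∑ k ∈ Finset.range m, 0 / ((k : ℝ) + 1))) :=
      tendsto_finsetSum _ fun k _ => (hpow (k + 1) k.succ_ne_zero).div_const _
    have h3 := (((hpow m hm).const_sub 1).mul h1).sub h2
    simpa using h3
  set Ψ : ℝ → ℝ := Function.update Φ 0 (-(harmonic m : ℝ)) with hΨ
  have hcont : ContinuousWithinAt Ψ (Ici 0) 0 := by
    rw [hΨ, continuousWithinAt_update_same, Ici_sdiff_left]
    exact hΦ0
  have hder : ∀ a ∈ Ioi (0 : ℝ), HasDerivAt Ψ (m * (((1 + a) ^ (m + 1))⁻¹ * log ((1 + a) / a))) a := by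
    intro a ha
    refine (hasDerivAt_harmonic_primitive m ha).congr_of_eventuallyEq ?_
    filter_upwards [isOpen_ne.mem_nhds (ne_of_gt ha)] with b hb
    exact Function.update_of_ne hb _ _
  have hpos : ∀ a ∈ Ioi (0 : ℝ), 0 ≤ (m : ℝ) * (((1 + a) ^ (m + 1))⁻¹ * log ((1 + a) / a)) := by
    intro a ha
    have ha' : 0 < a := ha
    have := log_ratio_nonneg ha'
    positivity
  have hinf : Tendsto Ψ atTop (𝓝 0) := by
    refine hΦinf.congr' ?_
    filter_upwards [eventually_ne_atTop 0] with b hb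
    exact (Function.update_of_ne hb _ _).symm
  have hint := integrableOn_Ioi_deriv_of_nonneg hcont hder hpos hinf
  have hval := integral_Ioi_of_hasDerivAt_of_nonneg hcont hder hpos hinf
  have hΨ0 : Ψ 0 = -(harmonic m : ℝ) := Function.update_self _ _ _
  rw [hΨ0, zero_sub, neg_neg] at hval
  rw [integral_const_mul] at hval
  have hint' : IntegrableOn (fun a : ℝ => ((1 + a) ^ (m + 1))⁻¹ * log ((1 + a) / a)) (Ioi 0) := by
    refine (hint.const_mul (m : ℝ)⁻¹).congr (ae_of_all _ fun a => ?_)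
    simp only
    field_simp
  rw [← ofReal_integral_eq_lintegral_ofReal hint']
  · congr 1
    rw [eq_div_iff hm0.ne', mul_comm, hval]
  · filter_upwards [ae_restrict_mem measurableSet_Ioi] with a ha
    have ha' : 0 < a := ha
    have := log_ratio_nonneg ha'
    show 0 ≤ ((1 + a) ^ (m + 1))⁻¹ * log ((1 + a) / a)
    positivity

/-! ### The radial integral: rescaling about `ρ = 1`, uniform bound, limit as `l → 0` -/

/-- The radial integral in the formula for the crossing volume, as a function of `E = exp l`. -/
def radialIntegral (d : ℕ) (E : ℝ) : ENNReal :=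
  ∫⁻ ρ in Ioo (0 : ℝ) 1, ENNReal.ofReal (ρ ^ (d - 1) * ((E / (E ^ 2 - ρ ^ 2)) ^ d *
    log ((E ^ 2 - ρ ^ 2) / (E * (1 - ρ ^ 2)))))

/-- The integrand of the radial integral in the variable `a = (1 - ρ) / (E - 1)`, up to a power
of `E - 1`. -/
def rescaledIntegrand (m : ℕ) (E a : ℝ) : ℝ :=
  (1 - (E - 1) * a) ^ m * (E / (E + (1 - (E - 1) * a))) ^ (m + 1) * ((1 + a) ^ (m + 1))⁻¹ *
    log ((1 + a) / a * ((E + (1 - (E - 1) * a)) / (E * (1 + (1 - (E - 1) * a)))))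

/-- For `ρ = 1 - (E - 1) a` in `(0, 1)`, each of `ρ`, `E/(E + ρ)` and `(E + ρ)/(E(1 + ρ))` is at
most `1`. The resulting majorant does not depend on `E`. -/
lemma rescaledIntegrand_le (m : ℕ) {E a : ℝ} (hE : 1 < E) (ha : 0 < a) (ha1 : (E - 1) * a < 1) :
    rescaledIntegrand m E a ≤ ((1 + a) ^ (m + 1))⁻¹ * log ((1 + a) / a) := by
  have hpos : 0 < (E - 1) * a := mul_pos (by linarith) ha
  rw [rescaledIntegrand]
  generalize hρ : 1 - (E - 1) * a = ρ
  have h0 : 0 < ρ := by linarith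
  have h1 : ρ < 1 := by linarith
  have hE0 : 0 < E := by linarith
  have hl : log ((1 + a) / a * ((E + ρ) / (E * (1 + ρ)))) ≤ log ((1 + a) / a) := by
    refine log_le_log (by positivity) ?_
    refine mul_le_of_le_one_right (by positivity) ?_
    rw [div_le_one (by positivity)]
    nlinarith
  have hc : ρ ^ m * (E / (E + ρ)) ^ (m + 1) ≤ 1 := by
    refine mul_le_one₀ (pow_le_one₀ h0.le h1.le) (by positivity) (pow_le_one₀ (by positivity) ?_)
    rw [div_le_one (by positivity)]
    linarith
  have hn := log_ratio_nonneg ha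
  calc _ ≤ ρ ^ m * (E / (E + ρ)) ^ (m + 1) * ((1 + a) ^ (m + 1))⁻¹ * log ((1 + a) / a) := by gcongr
    _ = ρ ^ m * (E / (E + ρ)) ^ (m + 1) * (((1 + a) ^ (m + 1))⁻¹ * log ((1 + a) / a)) := by ring
    _ ≤ 1 * (((1 + a) ^ (m + 1))⁻¹ * log ((1 + a) / a)) := by gcongr
    _ = _ := one_mul _

/-- Both `E^2 - ρ^2 = (E - 1)(1 + a)(E + ρ)` and `1 - ρ^2 = (E - 1) a (1 + ρ)` contain `E - 1`. It
cancels in the logarithm, and the Jacobian reduces the exponent outside from `m + 1` to `m`. The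
indicator keeps the domain independent of `E`. -/
theorem radialIntegral_eq_rescaled (m : ℕ) {E : ℝ} (hE : 1 < E) :
    radialIntegral (m + 1) E = ENNReal.ofReal (((E - 1) ^ m)⁻¹) *
      ∫⁻ a in Ioi (0 : ℝ), (Iio (E - 1)⁻¹).indicator
        (fun a => ENNReal.ofReal (rescaledIntegrand m E a)) a := by
  have hε : 0 < E - 1 := by linarith
  have him : (fun a : ℝ => 1 - (E - 1) * a) '' Ioo 0 (E - 1)⁻¹ = Ioo 0 1 := by
    ext ρ
    constructor
    · rintro ⟨a, ⟨h0, h1⟩, rfl⟩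
      have h2 := mul_pos hε h0
      have h3 : (E - 1) * a < 1 := by
        have := mul_lt_mul_of_pos_left h1 hε
        rwa [mul_inv_cancel₀ hε.ne'] at this
      exact ⟨by linarith, by linarith⟩
    · rintro ⟨h0, h1⟩
      refine ⟨(1 - ρ) / (E - 1), ⟨div_pos (by linarith) hε, ?_⟩, ?_⟩
      · rw [← one_div]
        exact div_lt_div_of_pos_right (by linarith) hε
      · show 1 - (E - 1) * ((1 - ρ) / (E - 1)) = ρ
        field_simp
        ring
  rw [radialIntegral, ← him, lintegral_image_eq_lintegral_abs_deriv_mul (f' := fun _ => -(E - 1))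
    measurableSet_Ioo (fun x _ => by
      simpa using (((hasDerivAt_id x).const_mul (E - 1)).const_sub 1).hasDerivWithinAt)
    (fun x _ y _ h => by simpa [hε.ne'] using h)]
  have hm : Measurable fun a => ENNReal.ofReal (rescaledIntegrand m E a) := by
    unfold rescaledIntegrand; fun_prop
  rw [← lintegral_const_mul _ (hm.indicator measurableSet_Iio), ← lintegral_indicator measurableSet_Ioi,
    ← lintegral_indicator measurableSet_Ioo]
  refine lintegral_congr fun a => ?_
  by_cases ha : 0 < a
  swap
  · simp [indicator, ha]
  by_cases ha1 : a < (E - 1)⁻¹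
  swap
  · simp [indicator, ha1]
  rw [indicator_of_mem (by exact ⟨ha, ha1⟩), indicator_of_mem (by exact ha),
    indicator_of_mem (by exact ha1), abs_neg, abs_of_pos hε, ← ENNReal.ofReal_mul hε.le,
    ← ENNReal.ofReal_mul (by positivity)]
  congr 1
  have h3 : (E - 1) * a < 1 := by
    have := mul_lt_mul_of_pos_left ha1 hε
    rwa [mul_inv_cancel₀ hε.ne'] at this
  have h4 : 0 < (E - 1) * a := mul_pos hε ha
  rw [rescaledIntegrand]
  generalize hρ : 1 - (E - 1) * a = ρ
  have h0 : 0 < ρ := by linarith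
  have e1 : E ^ 2 - ρ ^ 2 = (E - 1) * (1 + a) * (E + ρ) := by rw [← hρ]; ring
  have e2 : 1 - ρ ^ 2 = (E - 1) * a * (1 + ρ) := by rw [← hρ]; ring
  rw [e1, e2]
  have e3 : (E - 1) * (1 + a) * (E + ρ) / (E * ((E - 1) * a * (1 + ρ))) =
      (1 + a) / a * ((E + ρ) / (E * (1 + ρ))) := by
    field_simp
  have e4 : E / ((E - 1) * (1 + a) * (E + ρ)) = (E - 1)⁻¹ * (1 + a)⁻¹ * (E / (E + ρ)) := by
    field_simp
  rw [e3, e4, mul_pow, mul_pow, inv_pow, inv_pow, Nat.add_sub_cancel, pow_succ (E - 1)]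
  field_simp

lemma indicator_rescaledIntegrand_le (m : ℕ) {E a : ℝ} (hE : 1 < E) (ha : 0 < a) :
    (Iio (E - 1)⁻¹).indicator (fun a => ENNReal.ofReal (rescaledIntegrand m E a)) a ≤
      ENNReal.ofReal (((1 + a) ^ (m + 1))⁻¹ * log ((1 + a) / a)) := by
  have hε : 0 < E - 1 := by linarith
  by_cases ha1 : a < (E - 1)⁻¹
  · rw [indicator_of_mem (by exact ha1)]
    refine ENNReal.ofReal_le_ofReal (rescaledIntegrand_le m hE ha ?_)
    have := mul_lt_mul_of_pos_left ha1 hε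
    rwa [mul_inv_cancel₀ hε.ne'] at this
  · rw [indicator_of_notMem (by exact ha1)]
    exact zero_le

theorem radialIntegral_le {m : ℕ} (hm : m ≠ 0) {E : ℝ} (hE : 1 < E) :
    radialIntegral (m + 1) E ≤ ENNReal.ofReal (((E - 1) ^ m)⁻¹ * ((harmonic m : ℝ) / m)) := by
  have hε : 0 < E - 1 := by linarith
  rw [radialIntegral_eq_rescaled m hE, ENNReal.ofReal_mul (by positivity), ← lintegral_harmonic hm]
  exact mul_le_mul' le_rfl (setLIntegral_mono' measurableSet_Ioi fun a ha =>
    indicator_rescaledIntegrand_le m hE ha)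

lemma tendsto_id_div_exp_sub_one : Tendsto (fun l : ℝ => l / (exp l - 1)) (𝓝[>] 0) (𝓝 1) := by
  have h := (hasDerivAt_iff_tendsto_slope.1 (hasDerivAt_exp 0)).mono_left
    (nhdsWithin_mono (0 : ℝ) (fun x (hx : 0 < x) => hx.ne'))
  rw [exp_zero] at h
  have h2 := h.inv₀ one_ne_zero
  rw [inv_one] at h2
  refine h2.congr fun l => ?_
  rw [slope_def_field, exp_zero, sub_zero, inv_div]

/-- At `E = 1` the factor `E/(E + ρ)` becomes `1/2`, whence `2^(-(m+1))`, and the correction inside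
the logarithm becomes `1`. The prefactor is handled by `l / (exp l - 1) → 1`. -/
theorem tendsto_radialIntegral_zero {m : ℕ} (hm : m ≠ 0) :
    Tendsto (fun l : ℝ => l ^ m * (radialIntegral (m + 1) (exp l)).toReal) (𝓝[>] 0)
      (𝓝 ((2 ^ (m + 1))⁻¹ * ((harmonic m : ℝ) / m))) := by
  have hexp : Tendsto exp (𝓝[>] 0) (𝓝 1) := by
    have := continuous_exp.tendsto 0
    rw [exp_zero] at this
    exact this.mono_left nhdsWithin_le_nhds
  have hh : (0 : ℝ) ≤ (harmonic m : ℝ) / m := by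
    rw [← sum_inv_eq_harmonic]; positivity
  have hfin : ∫⁻ a in Ioi (0 : ℝ), ENNReal.ofReal (((1 + a) ^ (m + 1))⁻¹ * log ((1 + a) / a)) ≠ ⊤ := by
    rw [lintegral_harmonic hm]; exact ENNReal.ofReal_ne_top
  have hmeas : ∀ E, Measurable fun a => ENNReal.ofReal (rescaledIntegrand m E a) := fun E => by
    unfold rescaledIntegrand; fun_prop
  have h1 : Tendsto (fun l : ℝ => ∫⁻ a in Ioi (0 : ℝ), (Iio (exp l - 1)⁻¹).indicator
      (fun a => ENNReal.ofReal (rescaledIntegrand m (exp l) a)) a) (𝓝[>] 0)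
      (𝓝 (∫⁻ a in Ioi (0 : ℝ), ENNReal.ofReal ((2 ^ (m + 1))⁻¹) *
        ENNReal.ofReal (((1 + a) ^ (m + 1))⁻¹ * log ((1 + a) / a)))) := by
    refine tendsto_lintegral_filter_of_dominated_convergence _
      (Eventually.of_forall fun l => (hmeas _).indicator measurableSet_Iio) ?_ hfin ?_
    · filter_upwards [self_mem_nhdsWithin] with l hl
      filter_upwards [ae_restrict_mem measurableSet_Ioi] with a ha
      exact indicator_rescaledIntegrand_le m (one_lt_exp_iff.2 hl) ha
    · filter_upwards [ae_restrict_mem measurableSet_Ioi] with a ha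
      have ha' : 0 < a := ha
      rw [← ENNReal.ofReal_mul (by positivity)]
      have hc : ContinuousAt (fun E => rescaledIntegrand m E a) 1 := by
        unfold rescaledIntegrand
        refine ContinuousAt.mul (ContinuousAt.mul (ContinuousAt.mul (by fun_prop) ?_) (by fun_prop)) ?_
        · refine ContinuousAt.pow (ContinuousAt.div (by fun_prop) (by fun_prop) ?_) _
          norm_num
        · refine ContinuousAt.log (ContinuousAt.mul (by fun_prop)
            (ContinuousAt.div (by fun_prop) (by fun_prop) ?_)) ?_
          · norm_num
          · norm_num
            constructor <;> linarith
      have hv : rescaledIntegrand m 1 a =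
          (2 ^ (m + 1))⁻¹ * (((1 + a) ^ (m + 1))⁻¹ * log ((1 + a) / a)) := by
        unfold rescaledIntegrand
        norm_num
        rw [one_div, inv_pow]
        ring
      have hlim := ENNReal.tendsto_ofReal (hc.tendsto.comp hexp)
      rw [hv] at hlim
      refine hlim.congr' ?_
      have hsmall : Tendsto (fun l => (exp l - 1) * a) (𝓝[>] 0) (𝓝 0) := by
        simpa using (hexp.sub_const 1).mul_const a
      filter_upwards [self_mem_nhdsWithin, hsmall.eventually (gt_mem_nhds one_pos)] with l hl hl1
      have hε : 0 < exp l - 1 := by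
        have := one_lt_exp_iff.2 (show 0 < l from hl)
        linarith
      rw [indicator_of_mem]
      · rfl
      · rw [mem_Iio, ← one_div, lt_div_iff₀ hε, mul_comm]
        exact hl1
  rw [lintegral_const_mul _ (by fun_prop), lintegral_harmonic hm, ← ENNReal.ofReal_mul (by positivity)]
    at h1
  have h2 := (ENNReal.tendsto_toReal ENNReal.ofReal_ne_top).comp h1
  rw [ENNReal.toReal_ofReal (by positivity)] at h2
  have h3 := (tendsto_id_div_exp_sub_one.pow m).mul h2
  rw [one_pow, one_mul] at h3
  refine h3.congr' ?_
  filter_upwards [self_mem_nhdsWithin] with l hl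
  have hE : 1 < exp l := one_lt_exp_iff.2 hl
  have hε : 0 < exp l - 1 := by linarith
  rw [radialIntegral_eq_rescaled m hE, ENNReal.toReal_mul, ENNReal.toReal_ofReal (by positivity),
    ← mul_assoc, div_pow]
  rfl

/-! ### The radial integral as `l → ∞` -/

theorem tendsto_radialIntegral_atTop {d : ℕ} (hd : d ≠ 0) :
    Tendsto (fun l : ℝ => exp (d * l) / l * (radialIntegral d (exp l)).toReal) atTop
      (𝓝 (1 / d)) := by
  -- The normalized integrand, with `E^2` factored out of `E^2 - ρ^2`; it tends to `ρ^(d-1)`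
  -- pointwise.
  set Θ : ℝ → ℝ → ℝ := fun l ρ => ρ ^ (d - 1) * (((1 - ρ ^ 2 * exp (-(2 * l)))⁻¹) ^ d *
    ((l + log (1 - ρ ^ 2 * exp (-(2 * l))) - log (1 - ρ ^ 2)) / l)) with hΘ
  have hx : Tendsto (fun l : ℝ => exp (-(2 * l))) atTop (𝓝 0) :=
    tendsto_exp_neg_atTop_nhds_zero.comp (tendsto_id.const_mul_atTop two_pos)
  have hrew : ∀ l : ℝ, 0 < l → exp (d * l) / l * (radialIntegral d (exp l)).toReal =
      (∫⁻ ρ in Ioo (0 : ℝ) 1, ENNReal.ofReal (Θ l ρ)).toReal := by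
    intro l hl
    have hc : 0 ≤ exp (d * l) / l := by positivity
    rw [← ENNReal.toReal_ofReal hc, ← ENNReal.toReal_mul, radialIntegral,
      ← lintegral_const_mul _ (by fun_prop)]
    congr 1
    refine setLIntegral_congr_fun measurableSet_Ioo fun ρ hρ => ?_
    rw [← ENNReal.ofReal_mul hc]
    congr 1
    have h0 : 0 < ρ := hρ.1
    have hE : 1 < exp l := one_lt_exp_iff.2 hl
    have h1 : 0 < 1 - ρ ^ 2 := by nlinarith [hρ.2]
    have h2 : 0 < exp l ^ 2 - ρ ^ 2 := by nlinarith
    have e1 : exp (-(2 * l)) = (exp l ^ 2)⁻¹ := by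
      rw [exp_neg, ← exp_nat_mul]; norm_num
    have e2 : exp (d * l) = exp l ^ d := exp_nat_mul l d
    have e3 : 1 - ρ ^ 2 * (exp l ^ 2)⁻¹ = (exp l ^ 2 - ρ ^ 2) / exp l ^ 2 := by
      have := exp_pos l
      field_simp
    have e4 : log ((exp l ^ 2 - ρ ^ 2) / (exp l * (1 - ρ ^ 2))) =
        l + log ((exp l ^ 2 - ρ ^ 2) / exp l ^ 2) - log (1 - ρ ^ 2) := by
      rw [log_div h2.ne' (by positivity), log_mul (by positivity) h1.ne', log_div h2.ne' (by positivity),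
        log_pow, log_exp]
      push_cast
      ring
    simp only [hΘ]
    rw [e1, e2, e3, e4, div_pow, inv_div, div_pow]
    have := exp_pos l
    field_simp
    ring
  -- Majorant for `l ≥ 1`: there `exp (-2 l) ≤ 1/2` bounds the inverse by `2`, and division by `l ≥
  -- 1` does not enlarge `-log (1 - ρ)`.
  have hbound : ∫⁻ ρ in Ioo (0 : ℝ) 1, ENNReal.ofReal (2 ^ d * (1 - log (1 - ρ))) ≠ ⊤ := by
    have h1 : IntervalIntegrable (fun ρ : ℝ => log (1 - ρ)) volume 0 1 := by
      have := (intervalIntegral.intervalIntegrable_log' (a := 1) (b := 0)).comp_sub_left 1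
      simpa using this
    have h2 : IntervalIntegrable (fun ρ : ℝ => 2 ^ d * (1 - log (1 - ρ))) volume 0 1 :=
      (intervalIntegrable_const.sub h1).const_mul _
    rw [intervalIntegrable_iff_integrableOn_Ioo_of_le zero_le_one] at h2
    exact h2.lintegral_lt_top.ne
  have hlim : Tendsto (fun l => ∫⁻ ρ in Ioo (0 : ℝ) 1, ENNReal.ofReal (Θ l ρ)) atTop
      (𝓝 (∫⁻ ρ in Ioo (0 : ℝ) 1, ENNReal.ofReal (ρ ^ (d - 1)))) := by
    refine tendsto_lintegral_filter_of_dominated_convergence _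
      (Eventually.of_forall fun l => by simp only [hΘ]; fun_prop) ?_ hbound ?_
    · filter_upwards [eventually_ge_atTop 1] with l hl
      filter_upwards [ae_restrict_mem measurableSet_Ioo] with ρ hρ
      refine ENNReal.ofReal_le_ofReal ?_
      have h0 : 0 < ρ := hρ.1
      have h1 : ρ < 1 := hρ.2
      have hx0 := exp_pos (-(2 * l))
      have hx1 : exp (-(2 * l)) ≤ 1 / 2 := by
        have h3 : exp (-(2 * l)) ≤ exp (-1) := exp_le_exp.2 (by linarith)
        have h4 : exp (-1) ≤ 1 / 2 := by
          rw [exp_neg, ← one_div]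
          exact one_div_le_one_div_of_le two_pos (by linarith [add_one_le_exp (1 : ℝ)])
        linarith
      simp only [hΘ]
      generalize exp (-(2 * l)) = x at hx0 hx1
      have hρ2 : ρ ^ 2 ≤ 1 := by nlinarith
      have hy0 : 0 ≤ ρ ^ 2 * x := by positivity
      have hy : ρ ^ 2 * x ≤ 1 / 2 := by nlinarith
      have hinv : (1 - ρ ^ 2 * x)⁻¹ ≤ 2 := by
        rw [inv_le_comm₀ (by linarith) two_pos]; linarith
      have hinv0 : 0 ≤ (1 - ρ ^ 2 * x)⁻¹ := inv_nonneg.2 (by linarith)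
      have hl1 : log (1 - ρ ^ 2 * x) ≤ 0 := log_nonpos (by linarith) (by linarith)
      have hl2 : log (1 - ρ) ≤ log (1 - ρ ^ 2) := log_le_log (by linarith) (by nlinarith)
      have hl3 : log (1 - ρ) ≤ 0 := log_nonpos (by linarith) (by linarith)
      have hq : (l + log (1 - ρ ^ 2 * x) - log (1 - ρ ^ 2)) / l ≤ 1 - log (1 - ρ) := by
        rw [div_le_iff₀ (by linarith)]
        nlinarith
      have hp : ρ ^ (d - 1) ≤ 1 := pow_le_one₀ h0.le h1.le
      calc ρ ^ (d - 1) * ((1 - ρ ^ 2 * x)⁻¹ ^ d *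
            ((l + log (1 - ρ ^ 2 * x) - log (1 - ρ ^ 2)) / l))
          ≤ ρ ^ (d - 1) * ((1 - ρ ^ 2 * x)⁻¹ ^ d * (1 - log (1 - ρ))) := by gcongr
        _ ≤ 1 * (2 ^ d * (1 - log (1 - ρ))) := by
          have : 0 ≤ 1 - log (1 - ρ) := by linarith
          gcongr
        _ = _ := one_mul _
    · filter_upwards [ae_restrict_mem measurableSet_Ioo] with ρ hρ
      refine ENNReal.tendsto_ofReal ?_
      have hy : Tendsto (fun l : ℝ => 1 - ρ ^ 2 * exp (-(2 * l))) atTop (𝓝 1) := by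
        simpa using (hx.const_mul (ρ ^ 2)).const_sub 1
      have hlg : Tendsto (fun l : ℝ => log (1 - ρ ^ 2 * exp (-(2 * l)))) atTop (𝓝 0) := by
        simpa using hy.log one_ne_zero
      have hquot : Tendsto (fun l : ℝ => (l + log (1 - ρ ^ 2 * exp (-(2 * l))) - log (1 - ρ ^ 2)) / l)
          atTop (𝓝 1) := by
        have h1 : Tendsto (fun l : ℝ => 1 + (log (1 - ρ ^ 2 * exp (-(2 * l))) - log (1 - ρ ^ 2)) / l)
            atTop (𝓝 (1 + 0)) :=
          tendsto_const_nhds.add ((hlg.sub_const _).div_atTop tendsto_id)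
        rw [add_zero] at h1
        refine h1.congr' ?_
        filter_upwards [eventually_gt_atTop 0] with l hl
        field_simp
        ring
      simpa [hΘ] using (((hy.inv₀ one_ne_zero).pow d).mul hquot).const_mul (ρ ^ (d - 1))
  have hval : ∫⁻ ρ in Ioo (0 : ℝ) 1, ENNReal.ofReal (ρ ^ (d - 1)) = ENNReal.ofReal (1 / d) := by
    have h1 : IntervalIntegrable (fun ρ : ℝ => ρ ^ (d - 1)) volume 0 1 :=
      intervalIntegral.intervalIntegrable_pow _
    have h2 := h1
    rw [intervalIntegrable_iff_integrableOn_Ioo_of_le zero_le_one] at h2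
    rw [← ofReal_integral_eq_lintegral_ofReal h2]
    · rw [← integral_Ioc_eq_integral_Ioo, ← intervalIntegral.integral_of_le zero_le_one, integral_pow]
      obtain ⟨k, rfl⟩ := Nat.exists_eq_succ_of_ne_zero hd
      simp
    · filter_upwards [ae_restrict_mem measurableSet_Ioo] with ρ hρ
      exact pow_nonneg hρ.1.le _
  rw [hval] at hlim
  have h2 := (ENNReal.tendsto_toReal ENNReal.ofReal_ne_top).comp hlim
  rw [ENNReal.toReal_ofReal (by positivity)] at h2
  refine h2.congr' ?_
  filter_upwards [eventually_gt_atTop 0] with l hl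
  exact (hrew l hl).symm

/-! ### The constants -/

lemma volume_ball_real (k : ℕ) [NeZero k] :
    (volume (Metric.ball (0 : Euc k) 1)).toReal = π ^ ((k : ℝ) / 2) / Gamma ((k : ℝ) / 2 + 1) := by
  rw [EuclideanSpace.volume_ball]
  have h1 : (√π) ^ k = π ^ ((k : ℝ) / 2) := by
    rw [sqrt_eq_rpow, ← rpow_natCast, ← rpow_mul pi_pos.le]
    congr 1
    ring
  have h2 : 0 < Gamma ((k : ℝ) / 2 + 1) := Gamma_pos_of_pos (by positivity)
  simp only [ENNReal.ofReal_one, one_pow, one_mul, Fintype.card_fin, h1]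
  exact ENNReal.toReal_ofReal (by positivity)

lemma sphereVolume_real (k : ℕ) [NeZero k] :
    (sphereVolume k).real univ = 2 * π ^ ((k : ℝ) / 2) / Gamma ((k : ℝ) / 2) := by
  have hk : (0 : ℝ) < k := Nat.cast_pos.2 (Nat.pos_of_ne_zero (NeZero.ne k))
  have h2 : 0 < Gamma ((k : ℝ) / 2) := Gamma_pos_of_pos (by positivity)
  rw [sphereVolume, Measure.toSphere_real_apply_univ, finrank_euclideanSpace_fin, measureReal_def,
    volume_ball_real, Gamma_add_one (by positivity)]
  field_simp

theorem crossingVolume_eq_radialIntegral {d : ℕ} (hd : d ≠ 0) {l : ℝ} (hl : 0 < l) :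
    crossingVolume (d + 1) l = ENNReal.ofReal (2 ^ (d + 1)) *
      (volume (Metric.ball (0 : Euc d) 1) * (sphereVolume d univ * radialIntegral d (exp l))) :=
  crossingVolume_eq_lintegral_radial hd hl

/-- The constant is `2^(d+1) Vol(B^d) Vol(S^(d-1)) / Vol(S^d)`, written with Gamma functions. -/
theorem bridgemanKahn_eq {d : ℕ} (hd : d ≠ 0) {l : ℝ} (hl : 0 < l) :
    bridgemanKahn (d + 1) l = 2 ^ (d + 1) * (π ^ (((d : ℝ) - 1) / 2) * Gamma (((d : ℝ) + 1) / 2) /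
      (Gamma ((d : ℝ) / 2) * Gamma ((d : ℝ) / 2 + 1))) * (radialIntegral d (exp l)).toReal := by
  have : NeZero d := ⟨hd⟩
  have hd0 : (0 : ℝ) < d := Nat.cast_pos.2 (Nat.pos_of_ne_zero hd)
  have h1 := volume_ball_real d
  have h2 := sphereVolume_real d
  have h3 := sphereVolume_real (d + 1)
  rw [measureReal_def] at h2
  have hG1 : 0 < Gamma ((d : ℝ) / 2) := Gamma_pos_of_pos (by positivity)
  have hG2 : 0 < Gamma ((d : ℝ) / 2 + 1) := Gamma_pos_of_pos (by positivity)
  have hG3 : 0 < Gamma (((d : ℝ) + 1) / 2) := Gamma_pos_of_pos (by positivity)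
  rw [bridgemanKahn, crossingVolume_eq_radialIntegral hd hl, ENNReal.toReal_mul, ENNReal.toReal_mul,
    ENNReal.toReal_mul, h1, h2, h3, ENNReal.toReal_ofReal (by positivity)]
  push_cast
  have hpi : π ^ ((d : ℝ) / 2) * π ^ ((d : ℝ) / 2) =
      π ^ (((d : ℝ) - 1) / 2) * π ^ (((d : ℝ) + 1) / 2) := by
    rw [← rpow_add pi_pos, ← rpow_add pi_pos]
    congr 1
    ring
  have hp : 0 < π ^ (((d : ℝ) + 1) / 2) := by positivity
  field_simp
  rw [sq, hpi]
  ring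

end BridgemanKahn

end

/-! ### Finiteness, the upper bound and the two limits -/

theorem lemma1p3 (n : ℕ) [NeZero n] (hn : 3 ≤ n) :
    (∀ l : ℝ, 0 < l → BridgemanKahn.crossingVolume n l ≠ ⊤) ∧
    (∃ D : ℝ, 0 < D ∧ ∀ l : ℝ, 0 < l →
      BridgemanKahn.bridgemanKahn n l ≤ D / (exp l - 1) ^ (n - 2)) ∧
    Tendsto (fun l : ℝ => l ^ (n - 2) * BridgemanKahn.bridgemanKahn n l) (𝓝[>] 0)
      (𝓝 (π ^ (((n : ℝ) - 2) / 2) * (harmonic (n - 2) : ℝ) * Gamma (((n : ℝ) - 2) / 2) /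
        (Gamma (((n : ℝ) - 1) / 2) * Gamma (((n : ℝ) + 1) / 2)))) ∧
    Tendsto (fun l : ℝ => exp (((n : ℝ) - 1) * l) / l * BridgemanKahn.bridgemanKahn n l) atTop
      (𝓝 (2 ^ (n - 1) * π ^ (((n : ℝ) - 2) / 2) * Gamma ((n : ℝ) / 2) /
        Gamma (((n : ℝ) + 1) / 2) ^ 2)) := by
  open BridgemanKahn in
  obtain ⟨m, rfl⟩ : ∃ m, n = m + 1 + 1 := ⟨n - 2, by omega⟩
  have hm : m ≠ 0 := by omega
  have hm0 : (0 : ℝ) < m := Nat.cast_pos.2 (Nat.pos_of_ne_zero hm)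
  set C : ℝ := 2 ^ (m + 1 + 1) * (π ^ ((((m + 1 : ℕ) : ℝ) - 1) / 2) *
    Gamma ((((m + 1 : ℕ) : ℝ) + 1) / 2) /
      (Gamma (((m + 1 : ℕ) : ℝ) / 2) * Gamma (((m + 1 : ℕ) : ℝ) / 2 + 1))) with hC
  have hG0 : 0 < Gamma ((m : ℝ) / 2) := Gamma_pos_of_pos (by positivity)
  have hG1 : 0 < Gamma (((m : ℝ) + 1) / 2) := Gamma_pos_of_pos (by positivity)
  have hFC : ∀ l : ℝ, 0 < l → bridgemanKahn (m + 1 + 1) l =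
      C * (radialIntegral (m + 1) (exp l)).toReal := fun l hl => bridgemanKahn_eq m.succ_ne_zero hl
  have hH : 0 < (harmonic m : ℝ) := by exact_mod_cast harmonic_pos hm
  have e1 : (((m + 1 + 1 : ℕ) : ℝ) - 2) / 2 = (m : ℝ) / 2 := by push_cast; ring
  have e2 : (((m + 1 + 1 : ℕ) : ℝ) - 1) / 2 = ((m : ℝ) + 1) / 2 := by push_cast; ring
  have e3 : (((m + 1 + 1 : ℕ) : ℝ) + 1) / 2 = ((m : ℝ) + 1) / 2 + 1 := by push_cast; ring
  have e4 : ((m + 1 + 1 : ℕ) : ℝ) / 2 = (m : ℝ) / 2 + 1 := by push_cast; ring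
  have e5 : ((m + 1 + 1 : ℕ) : ℝ) - 1 = ((m + 1 : ℕ) : ℝ) := by push_cast; ring
  have e6 : (((m + 1 : ℕ) : ℝ) - 1) / 2 = (m : ℝ) / 2 := by push_cast; ring
  have e7 : (((m + 1 : ℕ) : ℝ) + 1) / 2 = (m : ℝ) / 2 + 1 := by push_cast; ring
  have e8 : ((m + 1 : ℕ) : ℝ) / 2 = ((m : ℝ) + 1) / 2 := by push_cast; ring
  have hCpos : 0 < C := by
    rw [hC, e6, e7, e8]
    have : 0 < Gamma ((m : ℝ) / 2 + 1) := Gamma_pos_of_pos (by positivity)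
    have : 0 < Gamma (((m : ℝ) + 1) / 2 + 1) := Gamma_pos_of_pos (by positivity)
    positivity
  refine ⟨fun l hl => ?_, ⟨C * ((harmonic m : ℝ) / m), by positivity, fun l hl => ?_⟩, ?_, ?_⟩
  · have hE : 1 < exp l := one_lt_exp_iff.2 hl
    have h1 : radialIntegral (m + 1) (exp l) ≠ ⊤ :=
      ne_top_of_le_ne_top ENNReal.ofReal_ne_top (radialIntegral_le hm hE)
    have : IsFiniteMeasure (sphereVolume (m + 1)) := by unfold sphereVolume; infer_instance
    rw [crossingVolume_eq_radialIntegral m.succ_ne_zero hl]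
    exact ENNReal.mul_ne_top ENNReal.ofReal_ne_top (ENNReal.mul_ne_top measure_ball_lt_top.ne
      (ENNReal.mul_ne_top (measure_ne_top _ _) h1))
  · have hE : 1 < exp l := one_lt_exp_iff.2 hl
    have hε : 0 < exp l - 1 := by linarith
    rw [hFC l hl, mul_div_assoc]
    refine mul_le_mul_of_nonneg_left ?_ hCpos.le
    have h1 := ENNReal.toReal_mono ENNReal.ofReal_ne_top (radialIntegral_le hm hE)
    rw [ENNReal.toReal_ofReal (by positivity)] at h1
    refine h1.trans (le_of_eq ?_)
    rw [show m + 1 + 1 - 2 = m by omega]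
    field_simp
  · have h1 := (tendsto_radialIntegral_zero hm).const_mul C
    rw [e1, e2, e3, show m + 1 + 1 - 2 = m by omega]
    -- `Γ(m/2 + 1) = (m/2) Γ(m/2)` absorbs the `1/m` and the remaining factor `2`.
    have hval : C * ((2 ^ (m + 1))⁻¹ * ((harmonic m : ℝ) / m)) =
        π ^ ((m : ℝ) / 2) * (harmonic m : ℝ) * Gamma ((m : ℝ) / 2) /
          (Gamma (((m : ℝ) + 1) / 2) * Gamma (((m : ℝ) + 1) / 2 + 1)) := by
      rw [hC, e6, e7, e8, Gamma_add_one (by positivity), pow_succ]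
      field_simp
    rw [hval] at h1
    refine h1.congr' ?_
    filter_upwards [self_mem_nhdsWithin] with l hl
    rw [hFC l hl]
    ring
  · have h1 := (tendsto_radialIntegral_atTop m.succ_ne_zero).const_mul C
    rw [e1, e3, e4, e5, show m + 1 + 1 - 1 = m + 1 by omega]
    -- `1/(m + 1)` turns `Γ((m+1)/2)` in the denominator into `2 Γ((m+1)/2 + 1)`, hence the square
    -- and one power of `2` less.
    have hval : C * (1 / ((m + 1 : ℕ) : ℝ)) = 2 ^ (m + 1) * π ^ ((m : ℝ) / 2) *
        Gamma ((m : ℝ) / 2 + 1) / Gamma (((m : ℝ) + 1) / 2 + 1) ^ 2 := by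
      rw [hC, e6, e7, e8, Gamma_add_one (s := ((m : ℝ) + 1) / 2) (by positivity), pow_succ]
      push_cast
      field_simp
    rw [hval] at h1
    refine h1.congr' ?_
    filter_upwards [eventually_gt_atTop 0] with l hl
    rw [hFC l hl]
    ring
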